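/- Let $L\ge 1$, $N\ge 0$ be integers and let $\Lambda=(\lambda_0,\lambda_1,\dots,\lambda_L)\in\mathbb R^{L+1}$. For $1\le t\le L$ let $\mathcal C_t$ be a copy of the Clifford torus $$\tfrac1{\sqrt2}\mathbb S^N\times\tfrac1{\sqrt2}\mathbb S^N=\{(X,Y)\in\mathbb R^{N+1}\times\mathbb R^{N+1} : \|X\|=\|Y\|=\tfrac1{\sqrt2}\}\subset\mathbb S^{2N+1}\subset\mathbb R^{2N+2}.$$ In $\mathbb R^{L(2N+2)+1}=\mathbb C^{(N+1)L}\times\mathbb R$ put $$F\big((X_t,Y_t)_t,\Theta,(r_t)_t\big)=\big(r_1e^{i\lambda_1\Theta}(X_1+iY_1),\dots,r_Le^{i\lambda_L\Theta}(X_L+iY_L),\lambda_0\Theta\big),$$ and let the generalized helicoid be $$\mathcal H^{\Lambda,\mathbf C}=\big\{F\big((X_t,Y_t)_t,\Theta,(r_t)_t\big) : \Theta\in\mathbb R,\ r_t\in\mathbb R,\ (X_t,Y_t)\in\mathcal C_t,\ 1\le t\le L\big\}.$$ (1) $\mathcal H^{\Lambda,\mathbf C}$ is a minimal submanifold of $\mathbb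 R^{L(2N+2)+1}$, possibly with self-intersections and singularities, in the following sense. If $\Lambda\neq0$, the map $F$ on the $(L(2N+1)+1)$-dimensional manifold $\mathcal C_1\times\dots\times\mathcal C_L\times\mathbb R\times\mathbb R^L$ is an immersion on a dense set of points, and its mean curvature vector (the trace of the second fundamental form with respect to the induced metric) vanishes at every point where it is an immersion. If $\Lambda=0$, then $F$ does not depend on $\Theta$, and the same holds for $F$ on the $L(2N+1)$-dimensional manifold given by $\Theta=0$ (the image being the product of $L$ Clifford cones). (2) $\mathcal H^{\Lambda,\mathbf C}$ is invariant under the multi-screw motion $\mathcal S_\Lambda$: for every $\theta\in\mathbb R$ the map $$(Z_1,\dots,Z_L,z)\mapsto\big(e^{i\lambda_1\theta}Z_1,\dots,e^{i\lambda_L\theta}Z_L,\ z+\lambda_0\theta\big),\qquad Z_t\in\mathbb C^{N+1},\ z\in\mathbb R,$$ maps $\mathcal H^{\Lambda,\mathbf C}$ onto itself. (3) If $\lambda_0=0$, then $\mathcal H^{\Lambda,\mathbf C}$ lies in $\mathbb R^{L(2N+2)}\times\{0\}$ and, as a subset of $\mathbb R^{L(2N+2)}$, it is a cone (closed under multiplication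 by every real number) and is minimal in $\mathbb R^{L(2N+2)}$ in the same sense as in (1), with $F$ replaced by its component in $\mathbb C^{(N+1)L}=\mathbb R^{L(2N+2)}$. -/

import Mathlib

open scoped ContDiff

noncomputable section

/-! ### Mean curvature of an immersed patch -/

section MeanCurvature

variable {E : Type*} [NormedAddCommGroup E] [InnerProductSpace ℝ E] {d : ℕ}

/-- The matrix `g_ij = ∂_i f · ∂_j f` of the first fundamental form of `f : ℝ^d → E` at `u`. -/
def firstFundamentalForm (f : EuclideanSpace ℝ (Fin d) → E) (u : EuclideanSpace ℝ (Fin d)) :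
    Matrix (Fin d) (Fin d) ℝ :=
  Matrix.of fun i j =>
    inner ℝ (fderiv ℝ f u (EuclideanSpace.single i 1)) (fderiv ℝ f u (EuclideanSpace.single j 1))

/-- The vector-valued second fundamental form of `f` at `u`: the component of the second derivative
`D²f(u)(v, w)` orthogonal to the tangent space, the range of `Df(u)`. -/
def secondFundamentalForm (f : EuclideanSpace ℝ (Fin d) → E) (u v w : EuclideanSpace ℝ (Fin d)) :
    E :=
  (LinearMap.range (fderiv ℝ f u).toLinearMap)ᗮ.starProjection
    (fderiv ℝ (fun x => fderiv ℝ f x) u v w)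

/-- The mean curvature vector of `f` at `u`: the trace of the second fundamental form with respect
to the induced metric, `∑ g^{ij} II(∂_i, ∂_j)`. -/
def meanCurvatureVector (f : EuclideanSpace ℝ (Fin d) → E) (u : EuclideanSpace ℝ (Fin d)) : E :=
  ∑ i, ∑ j, (firstFundamentalForm f u)⁻¹ i j •
    secondFundamentalForm f u (EuclideanSpace.single i 1) (EuclideanSpace.single j 1)

end MeanCurvature

/-! ### Minimal submanifolds given by a parametrization -/

section Parametrized

variable {A : Type*} [NormedAddCommGroup A] [NormedSpace ℝ A]
variable {E : Type*} [NormedAddCommGroup E] [InnerProductSpace ℝ E]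

/-- `φ` is a smooth regular (immersive) local parametrization, with parameters in the open set
`V ⊆ ℝ^d`, of a `d`-dimensional submanifold `M` of the vector space `A`. -/
structure IsLocalParametrization (d : ℕ) (M : Set A) (V : Set (EuclideanSpace ℝ (Fin d)))
    (φ : EuclideanSpace ℝ (Fin d) → A) : Prop where
  isOpen : IsOpen V
  contDiffOn : ContDiffOn ℝ ∞ φ V
  injective_fderiv : ∀ u ∈ V, Function.Injective (fderiv ℝ φ u)
  mapsTo : Set.MapsTo φ V M

/-- The points of the `d`-dimensional submanifold `M` at which the restriction of `F` to `M` is an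
immersion. -/
def regularPoints (d : ℕ) (M : Set A) (F : A → E) : Set A :=
  {p | ∃ (V : Set (EuclideanSpace ℝ (Fin d))) (φ : EuclideanSpace ℝ (Fin d) → A),
    IsLocalParametrization d M V φ ∧
      ∃ u ∈ V, φ u = p ∧ Function.Injective (fderiv ℝ (F ∘ φ) u)}

/-- `M` is a `d`-dimensional embedded smooth submanifold of the vector space `A`: near each point it
is the image of an immersive local parametrization with a continuous inverse. -/
def IsEmbeddedSubmanifold (d : ℕ) (M : Set A) : Prop :=
  ∀ p ∈ M, ∃ (V : Set (EuclideanSpace ℝ (Fin d))) (φ : EuclideanSpace ℝ (Fin d) → A)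
    (W : Set A) (ψ : A → EuclideanSpace ℝ (Fin d)),
    IsLocalParametrization d M V φ ∧ IsOpen W ∧ p ∈ W ∧ φ '' V = M ∩ W ∧
      ContinuousOn ψ (M ∩ W) ∧ ∀ u ∈ V, ψ (φ u) = u

/-- `S` is a `d`-dimensional minimal submanifold of `E`, possibly with self-intersections and
singularities, with parametrization `F : M → E`: the set `S` is the image under the smooth map `F`
of the `d`-dimensional manifold `M`, the restriction of `F` to `M` is an immersion on a dense subset
of `M`, and the mean curvature vector vanishes wherever it is an immersion, in every local
parametrization of `M`. -/
structure IsMinimalSubmanifoldWith (d : ℕ) (M : Set A) (F : A → E) (S : Set E) : Prop where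
  image_eq : F '' M = S
  contDiff : ContDiff ℝ ∞ F
  isEmbeddedSubmanifold : IsEmbeddedSubmanifold d M
  dense_regular : M ⊆ closure (regularPoints d M F)
  minimal : ∀ (V : Set (EuclideanSpace ℝ (Fin d))) (φ : EuclideanSpace ℝ (Fin d) → A),
    IsLocalParametrization d M V φ → ∀ u ∈ V, Function.Injective (fderiv ℝ (F ∘ φ) u) →
      meanCurvatureVector (F ∘ φ) u = 0

end Parametrized

/-! ### Clifford tori, multi-screw motions and generalized helicoids -/

/-- The Clifford torus `(1/√2) S^N × (1/√2) S^N`, as a set of pairs `(X, Y)` in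
`ℝ^{N+1} × ℝ^{N+1}`. -/
def cliffordTorus (N : ℕ) :
    Set (EuclideanSpace ℝ (Fin (N + 1)) × EuclideanSpace ℝ (Fin (N + 1))) :=
  Metric.sphere 0 (1 / √2) ×ˢ Metric.sphere 0 (1 / √2)

/-- `ℝ^{L(2N+2)} = ℂ^{(N+1)L}`: `L` blocks of `N + 1` complex coordinates, with the Euclidean norm
and the real inner product. -/
abbrev ComplexBlocks (L N : ℕ) : Type := EuclideanSpace ℂ (Fin L × Fin (N + 1))

/-- `ℝ^{L(2N+2)+1} = ℂ^{(N+1)L} × ℝ` with the Euclidean norm. -/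
abbrev HelicoidSpace (L N : ℕ) : Type := WithLp 2 (ComplexBlocks L N × ℝ)

/-- The parameters `((X_t, Y_t)_t, Θ, (r_t)_t)`. -/
abbrev HelicoidParam (L N : ℕ) : Type :=
  (Fin L → EuclideanSpace ℝ (Fin (N + 1)) × EuclideanSpace ℝ (Fin (N + 1))) × ℝ × (Fin L → ℝ)

/-- The component of a helicoid point in `ℂ^{(N+1)L}`, whose `t`-th block is
`r_t e^{i λ_t Θ} (X_t + i Y_t)`; here `Λ = (λ_0, λ_1, …, λ_L)`. -/
def helicoidConeMap {L : ℕ} (N : ℕ) (Λ : Fin (L + 1) → ℝ) (p : HelicoidParam L N) :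
    ComplexBlocks L N :=
  WithLp.toLp 2 fun tk : Fin L × Fin (N + 1) =>
    (p.2.2 tk.1 : ℂ) * Complex.exp (Complex.I * ((Λ tk.1.succ * p.2.1 : ℝ) : ℂ)) *
      (((p.1 tk.1).1 tk.2 : ℂ) + Complex.I * ((p.1 tk.1).2 tk.2 : ℂ))

/-- The map `((X_t, Y_t)_t, Θ, (r_t)_t) ↦ ((r_t e^{i λ_t Θ} (X_t + i Y_t))_t, λ_0 Θ)`. -/
def helicoidMap {L : ℕ} (N : ℕ) (Λ : Fin (L + 1) → ℝ) (p : HelicoidParam L N) :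
    HelicoidSpace L N :=
  WithLp.toLp 2 (helicoidConeMap N Λ p, Λ 0 * p.2.1)

/-- The admissible parameters: each `(X_t, Y_t)` on the Clifford torus, `Θ` and the `r_t` arbitrary
reals. -/
def helicoidDomain (L N : ℕ) : Set (HelicoidParam L N) :=
  {p | ∀ t, p.1 t ∈ cliffordTorus N}

/-- The admissible parameters with `Θ = 0`. For `Λ = 0` the parameter `Θ` plays no role, and the
helicoid is the product of `L` Clifford cones, which has one dimension less. -/
def productConeDomain (L N : ℕ) : Set (HelicoidParam L N) :=
  {p | (∀ t, p.1 t ∈ cliffordTorus N) ∧ p.2.1 = 0}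

/-- The generalized helicoid `H^{Λ, C}` in `ℝ^{L(2N+2)+1}`. -/
def generalizedHelicoid {L : ℕ} (N : ℕ) (Λ : Fin (L + 1) → ℝ) : Set (HelicoidSpace L N) :=
  {q | ∃ (X Y : Fin L → EuclideanSpace ℝ (Fin (N + 1))) (Θ : ℝ) (r : Fin L → ℝ),
    (∀ t, (X t, Y t) ∈ cliffordTorus N) ∧
    (∀ t k, q.fst (t, k) =
      (r t : ℂ) * Complex.exp (Complex.I * ((Λ t.succ * Θ : ℝ) : ℂ)) *
        ((X t k : ℂ) + Complex.I * (Y t k : ℂ))) ∧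
    q.snd = Λ 0 * Θ}

/-- The projection of the generalized helicoid to `ℝ^{L(2N+2)}`; for `λ_0 = 0` the helicoid lies in
the hyperplane `ℝ^{L(2N+2)} × {0}` and is identified with this set. -/
def generalizedHelicoidCone {L : ℕ} (N : ℕ) (Λ : Fin (L + 1) → ℝ) : Set (ComplexBlocks L N) :=
  (fun q : HelicoidSpace L N => q.fst) '' generalizedHelicoid N Λ

/-- The multi-screw motion `S_Λ` of `ℝ^{L(2N+2)+1}` with pitch vector `Λ` and angle `θ`:
`((Z_t)_t, z) ↦ ((e^{i λ_t θ} Z_t)_t, z + λ_0 θ)`. -/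
def multiScrewMotion {L N : ℕ} (Λ : Fin (L + 1) → ℝ) (θ : ℝ) (q : HelicoidSpace L N) :
    HelicoidSpace L N :=
  WithLp.toLp 2
    (WithLp.toLp 2 fun tk : Fin L × Fin (N + 1) =>
      Complex.exp (Complex.I * ((Λ tk.1.succ * θ : ℝ) : ℂ)) * q.fst tk,
    q.snd + Λ 0 * θ)

end

/-! The proof is a reflection argument. At an immersion point p, an isometry `R` of the target is
found that is induced by a symmetry of the parameter manifold fixing p and acts as -1 on the normal
space. The second fundamental form then changes sign under the induced tangent isometry `T`, while
its trace cannot change, so the mean curvature vector H satisfies H = -H.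

The symmetry exists because ‖X_t‖ = ‖Y_t‖: a reflection ρ_t exchanges the two vectors. Send (X, Y)
to (ρ Y, ρ X) in each block, reflect Θ about its value at p and keep r. In the frame rotated by
e^{iλ_tΘ} at p, reversing the angle matches swapping real and imaginary parts, so F intertwines this
symmetry with the isometry (u, v) ↦ (ρ v, ρ u), extended by -1 on the axis. Its fixed vectors are
(m, ρ m). Splitting m into its X_t-part and a part ξ orthogonal to X_t exhibits (m, ρ m) as a
tangent vector: the first part comes from varying r_t, the second from moving X_t and Y_t. This is
`hasReversingSymmetry_helicoidConeMap`. Only the second part needs r_t ≠ 0, which holds at an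
immersion point unless the torus is discrete and ξ = 0 anyway.

`isMinimalSubmanifoldWith_levelSet` turns such symmetries into minimality for maps on a regular
level set, without choosing charts. Its density hypothesis comes from `mem_closure_generic` and
`eq_zero_of_fderiv_helicoidConeMap_eq_zero`: the cone map is immersive where every r_t is nonzero
and some λ_t ⟨X_t, Y_t⟩ is nonzero. If λ_0 ≠ 0, or if Θ is held fixed, the condition on ⟨X_t, Y_t⟩
is not needed. -/

open Module

noncomputable section

/-! ### Second derivatives under composition and linear symmetries -/

section SecondDerivative

variable {A E : Type*} [NormedAddCommGroup A] [NormedSpace ℝ A]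
  [NormedAddCommGroup E] [NormedSpace ℝ E]

/-- The second derivative of a composition. -/
theorem fderiv_fderiv_comp {D : Type*} [NormedAddCommGroup D] [NormedSpace ℝ D] {f : A → E}
    {φ : D → A} {u : D} (hf : ContDiff ℝ 2 f) (hφ : ContDiffAt ℝ 2 φ u) (v w : D) :
    fderiv ℝ (fun x => fderiv ℝ (f ∘ φ) x) u v w =
      fderiv ℝ (fun x => fderiv ℝ f x) (φ u) (fderiv ℝ φ u v) (fderiv ℝ φ u w) +
        fderiv ℝ f (φ u) (fderiv ℝ (fun x => fderiv ℝ φ x) u v w) := by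
  have hev : (fun x => fderiv ℝ (f ∘ φ) x) =ᶠ[nhds u]
      fun x => (fderiv ℝ f (φ x)).comp (fderiv ℝ φ x) := by
    filter_upwards [hφ.eventually (by simp)] with x hx
    exact fderiv_comp x (hf.differentiable (by norm_num) _) (hx.differentiableAt (by norm_num))
  have hφ1 : HasFDerivAt φ (fderiv ℝ φ u) u :=
    (hφ.differentiableAt (by norm_num)).hasFDerivAt
  have hφ2 : HasFDerivAt (fun x => fderiv ℝ φ x) (fderiv ℝ (fun x => fderiv ℝ φ x) u) u :=
    ((hφ.fderiv_right (m := 1) (by norm_num)).differentiableAt (by norm_num)).hasFDerivAt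
  have hf2 : HasFDerivAt (fun x => fderiv ℝ f x) (fderiv ℝ (fun x => fderiv ℝ f x) (φ u)) (φ u) :=
    ((hf.fderiv_right (m := 1) (by norm_num)).differentiable (by norm_num) _).hasFDerivAt
  have hc : HasFDerivAt (fun x => (fderiv ℝ f (φ x)).comp (fderiv ℝ φ x)) _ u :=
    (hf2.comp u hφ1).clm_comp hφ2
  rw [hev.fderiv_eq, hc.fderiv]
  simp [add_comm]

/-- The first derivative of a map which intertwines linear maps near `p`. -/
theorem fderiv_intertwine {f : A → E} (hf : ContDiff ℝ 2 f) {S : A →L[ℝ] A} {R : E →L[ℝ] E} {p : A}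
    (hS : ∀ z, f (p + S z) - f p = R (f (p + z) - f p)) (z a : A) :
    fderiv ℝ f (p + S z) (S a) = R (fderiv ℝ f (p + z) a) := by
  have hd := hf.differentiable (by norm_num)
  have h1 : HasFDerivAt (fun z => f (p + S z) - f p) ((fderiv ℝ f (p + S z)).comp S) z :=
    ((hd _).hasFDerivAt.comp z (S.hasFDerivAt.const_add p)).sub_const _
  have h2 : HasFDerivAt (fun z => R (f (p + z) - f p))
      (R.comp ((fderiv ℝ f (p + z)).comp (ContinuousLinearMap.id ℝ A))) z :=
    R.hasFDerivAt.comp z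
      (((hd _).hasFDerivAt.comp z ((hasFDerivAt_id z).const_add p)).sub_const _)
  rw [show (fun z => f (p + S z) - f p) = fun z => R (f (p + z) - f p) from funext hS] at h1
  simpa using congrArg (fun T : A →L[ℝ] E => T a) (h1.unique h2)

/-- The second derivative of a map which intertwines linear maps near `p`. -/
theorem fderiv_fderiv_intertwine {f : A → E} (hf : ContDiff ℝ 2 f) {S : A →L[ℝ] A}
    {R : E →L[ℝ] E} {p : A} (hS : ∀ z, f (p + S z) - f p = R (f (p + z) - f p)) (a b : A) :
    fderiv ℝ (fun x => fderiv ℝ f x) p (S a) (S b) =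
      R (fderiv ℝ (fun x => fderiv ℝ f x) p a b) := by
  have hd : ∀ x, HasFDerivAt (fun x => fderiv ℝ f x) (fderiv ℝ (fun x => fderiv ℝ f x) x) x :=
    fun x => ((hf.fderiv_right (m := 1) (by norm_num)).differentiable (by norm_num) x).hasFDerivAt
  have h1 : HasFDerivAt (fun z => fderiv ℝ f (p + S z))
      ((fderiv ℝ (fun x => fderiv ℝ f x) (p + S 0)).comp S) 0 :=
    (hd _).comp (0 : A) (S.hasFDerivAt.const_add p)
  have h2 : HasFDerivAt (fun z => fderiv ℝ f (p + z))
      ((fderiv ℝ (fun x => fderiv ℝ f x) (p + 0)).comp (ContinuousLinearMap.id ℝ A)) 0 :=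
    (hd _).comp (0 : A) ((hasFDerivAt_id (0 : A)).const_add p)
  have h3 := h1.clm_apply (hasFDerivAt_const (S b) (0 : A))
  have h4 := R.hasFDerivAt.comp (0 : A) (h2.clm_apply (hasFDerivAt_const b (0 : A)))
  rw [show (fun z => fderiv ℝ f (p + S z) (S b)) = R ∘ fun z => fderiv ℝ f (p + z) b from
    funext fun z => fderiv_intertwine hf hS z b] at h3
  simpa using congrArg (fun T : A →L[ℝ] E => T a) (h3.unique h4)

end SecondDerivative

/-! ### Vanishing of a trace that an isometry reverses -/

section Trace

variable {E : Type*} [NormedAddCommGroup E] [InnerProductSpace ℝ E] {d : ℕ}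

theorem sum_sum_sum_sum_comm {ι M : Type*} [Fintype ι] [AddCommMonoid M]
    (f : ι → ι → ι → ι → M) :
    ∑ k, ∑ l, ∑ j, ∑ i, f k l i j = ∑ i, ∑ j, ∑ k, ∑ l, f k l i j := by
  calc ∑ k, ∑ l, ∑ j, ∑ i, f k l i j = ∑ k, ∑ j, ∑ i, ∑ l, f k l i j :=
        Finset.sum_congr rfl fun k _ => by
          rw [Finset.sum_comm]
          exact Finset.sum_congr rfl fun j _ => Finset.sum_comm
    _ = ∑ j, ∑ i, ∑ k, ∑ l, f k l i j := by
        rw [Finset.sum_comm]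
        exact Finset.sum_congr rfl fun j _ => Finset.sum_comm
    _ = ∑ i, ∑ j, ∑ k, ∑ l, f k l i j := Finset.sum_comm

/-- If an endomorphism `T` preserves the first fundamental form and reverses the sign of the second
one, the mean curvature vector vanishes. -/
theorem meanCurvatureVector_eq_zero_of_neg {f : EuclideanSpace ℝ (Fin d) → E}
    {u : EuclideanSpace ℝ (Fin d)} (hinj : Function.Injective (fderiv ℝ f u))
    (T : EuclideanSpace ℝ (Fin d) →ₗ[ℝ] EuclideanSpace ℝ (Fin d))
    (hT : ∀ v w, inner ℝ (fderiv ℝ f u (T v)) (fderiv ℝ f u (T w)) =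
      inner ℝ (fderiv ℝ f u v) (fderiv ℝ f u w))
    (hII : ∀ v w, secondFundamentalForm f u (T v) (T w) = -secondFundamentalForm f u v w) :
    meanCurvatureVector f u = 0 := by
  set g := firstFundamentalForm f u with hg
  set b : Fin d → EuclideanSpace ℝ (Fin d) := fun i => EuclideanSpace.single i 1 with hb
  set τ : Matrix (Fin d) (Fin d) ℝ := Matrix.of fun k i => T (b i) k with hτ
  have hexp : ∀ i, T (b i) = ∑ k, τ k i • b k := by
    intro i
    ext l
    simp [hτ, hb, Pi.single_apply]
  have hgτ : τ.transpose * g * τ = g := by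
    ext i j
    have := hT (b i) (b j)
    rw [hexp i, hexp j] at this
    simp only [map_sum, map_smul] at this
    rw [sum_inner] at this
    simp only [inner_sum, inner_smul_left, inner_smul_right] at this
    rw [hg, Matrix.mul_apply]
    simp only [Matrix.mul_apply, Matrix.transpose_apply, Finset.sum_mul]
    rw [Finset.sum_comm]
    refine Eq.trans ?_ this
    refine Finset.sum_congr rfl fun k _ => Finset.sum_congr rfl fun l _ => ?_
    simp [firstFundamentalForm, hb]
    ring
  -- The Gram matrix of linearly independent vectors is positive definite.
  have hdet : IsUnit g.det := by
    have hli : LinearIndependent ℝ fun i => fderiv ℝ f u (b i) := by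
      have := (EuclideanSpace.basisFun (Fin d) ℝ).toBasis.linearIndependent.map'
        (fderiv ℝ f u).toLinearMap (LinearMap.ker_eq_bot.mpr hinj)
      simpa [Function.comp_def, hb] using this
    exact (Matrix.posDef_gram_of_linearIndependent hli).det_pos.ne'.isUnit
  -- From τᵀ g τ = g, the matrix g⁻¹ τᵀ g is a left inverse of τ, hence also a right inverse. This
  -- is the invariance of the inverse metric.
  have hinv : τ * g⁻¹ * τ.transpose = g⁻¹ := by
    have h1 : (g⁻¹ * τ.transpose * g) * τ = 1 := by
      rw [Matrix.mul_assoc, Matrix.mul_assoc, ← Matrix.mul_assoc τ.transpose, hgτ,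
        Matrix.nonsing_inv_mul _ hdet]
    have h2 := mul_eq_one_comm.mp h1
    calc τ * g⁻¹ * τ.transpose = τ * (g⁻¹ * τ.transpose * g) * g⁻¹ := by
          simp only [Matrix.mul_assoc, Matrix.mul_nonsing_inv _ hdet, Matrix.mul_one]
      _ = g⁻¹ := by rw [h2, Matrix.one_mul]
  have hbil : ∀ i j, secondFundamentalForm f u (T (b i)) (T (b j)) =
      ∑ k, ∑ l, (τ k i * τ l j) • secondFundamentalForm f u (b k) (b l) := by
    intro i j
    rw [hexp i, hexp j]
    simp only [secondFundamentalForm, map_sum, map_smul, sum_apply,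
      smul_apply, Finset.smul_sum, smul_smul]
    rw [Finset.sum_comm]
    refine Finset.sum_congr rfl fun k _ => Finset.sum_congr rfl fun l _ => ?_
    rw [mul_comm]
  have hneg : meanCurvatureVector f u = -meanCurvatureVector f u := by
    calc meanCurvatureVector f u
        = ∑ k, ∑ l, (τ * g⁻¹ * τ.transpose) k l • secondFundamentalForm f u (b k) (b l) := by
          rw [hinv]; rfl
      _ = ∑ i, ∑ j, g⁻¹ i j • secondFundamentalForm f u (T (b i)) (T (b j)) := by
          simp only [hbil, Matrix.mul_apply, Matrix.transpose_apply, Finset.sum_mul,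
            Finset.sum_smul, Finset.smul_sum, smul_smul]
          refine Eq.trans ?_ (sum_sum_sum_sum_comm _)
          refine Finset.sum_congr rfl fun k _ => Finset.sum_congr rfl fun l _ =>
            Finset.sum_congr rfl fun j _ => Finset.sum_congr rfl fun i _ => ?_
          congr 1
          ring
      _ = -meanCurvatureVector f u := by
          simp only [hII, smul_neg, Finset.sum_neg_distrib]; rfl
  have := (two_smul ℝ (meanCurvatureVector f u)).trans (eq_neg_iff_add_eq_zero.mp hneg)
  simpa using this

end Trace

/-! ### Regular level sets and the symmetry criterion for minimality -/

section LevelSets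

variable {A B : Type*} [NormedAddCommGroup A] [NormedSpace ℝ A]
  [NormedAddCommGroup B] [NormedSpace ℝ B] {d : ℕ}

/-- The differential of a local parametrization of a level set maps into the kernel. -/
theorem IsLocalParametrization.fderiv_levelSet_eq_zero {h : A → B} (hh : ContDiff ℝ ∞ h) {c : B}
    {V : Set (EuclideanSpace ℝ (Fin d))} {φ : EuclideanSpace ℝ (Fin d) → A}
    (hφ : IsLocalParametrization d (h ⁻¹' {c}) V φ) {u : EuclideanSpace ℝ (Fin d)} (hu : u ∈ V)
    (v : EuclideanSpace ℝ (Fin d)) : fderiv ℝ h (φ u) (fderiv ℝ φ u v) = 0 := by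
  have h1 : h ∘ φ =ᶠ[nhds u] fun _ => c := by
    filter_upwards [hφ.isOpen.mem_nhds hu] with x hx
    exact hφ.mapsTo hx
  have h2 : fderiv ℝ (h ∘ φ) u = fderiv ℝ (fun _ => c) u := h1.fderiv_eq
  rw [fderiv_comp u (hh.differentiable (by simp) _)
    ((hφ.contDiffOn.contDiffAt (hφ.isOpen.mem_nhds hu)).differentiableAt (by simp))] at h2
  simpa using congrArg (fun T : EuclideanSpace ℝ (Fin d) →L[ℝ] B => T v) h2

variable [FiniteDimensional ℝ A]

/-- The kernel of a surjective differential has the dimension of the level set. -/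
theorem finrank_ker_of_surjective {T : A →L[ℝ] B} (hT : Function.Surjective T)
    (hd : finrank ℝ A = d + finrank ℝ B) : finrank ℝ (LinearMap.ker T.toLinearMap) = d := by
  have h1 := LinearMap.finrank_range_add_finrank_ker T.toLinearMap
  rw [LinearMap.range_eq_top.mpr hT, finrank_top] at h1
  omega

variable {E : Type*} [NormedAddCommGroup E] [InnerProductSpace ℝ E]

variable [FiniteDimensional ℝ B] in
/-- Regular level sets are embedded submanifolds. -/
theorem isEmbeddedSubmanifold_levelSet {h : A → B} (hh : ContDiff ℝ ∞ h) (c : B)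
    (hsurj : ∀ p, h p = c → Function.Surjective (fderiv ℝ h p))
    (hd : finrank ℝ A = d + finrank ℝ B) : IsEmbeddedSubmanifold d (h ⁻¹' {c}) := by
  intro p hp
  have hpc : h p = c := hp
  have : CompleteSpace A := FiniteDimensional.complete ℝ A
  set K := LinearMap.ker (fderiv ℝ h p).toLinearMap with hK
  have hKd : finrank ℝ K = finrank ℝ (EuclideanSpace ℝ (Fin d)) := by
    rw [finrank_ker_of_surjective (hsurj p hpc) hd]; simp
  -- Any linear projection onto the tangent space serves as a chart; `h` together with it is a local
  -- diffeomorphism at p.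
  obtain ⟨π, hπ⟩ := LinearMap.exists_leftInverse_of_injective K.subtype (Submodule.ker_subtype K)
  let e := LinearEquiv.ofFinrankEq K (EuclideanSpace ℝ (Fin d)) hKd
  let ψ : A →L[ℝ] EuclideanSpace ℝ (Fin d) := LinearMap.toContinuousLinearMap (e.toLinearMap ∘ₗ π)
  have hψ : ∀ k : K, ψ k = e k := fun k => by
    have := congrArg (fun T : K →ₗ[ℝ] K => T k) hπ
    simp only [LinearMap.comp_apply, Submodule.subtype_apply, LinearMap.id_apply] at this
    simp [ψ, this]
  let Ψ : A → B × EuclideanSpace ℝ (Fin d) := fun x => (h x, ψ x)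
  have hΨ : ContDiff ℝ ∞ Ψ := hh.prodMk ψ.contDiff
  have hΨ' : ∀ x, HasFDerivAt Ψ ((fderiv ℝ h x).prod ψ) x := fun x =>
    ((hh.differentiable (by simp) x).hasFDerivAt).prodMk ψ.hasFDerivAt
  have hinj : Function.Injective ((fderiv ℝ h p).prod ψ).toLinearMap := by
    rw [← LinearMap.ker_eq_bot, LinearMap.ker_eq_bot']
    intro z hz
    have hz1 : fderiv ℝ h p z = 0 := congrArg Prod.fst hz
    have hz2 : ψ z = 0 := congrArg Prod.snd hz
    have h3 := hψ ⟨z, hz1⟩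
    rw [hz2] at h3
    simpa using congrArg Subtype.val (e.map_eq_zero_iff.mp h3.symm)
  have hfr : finrank ℝ A = finrank ℝ (B × EuclideanSpace ℝ (Fin d)) := by
    rw [hd, Module.finrank_prod]; simp [add_comm]
  let T := (LinearMap.linearEquivOfInjective _ hinj hfr).toContinuousLinearEquiv
  have hT : (T : A →L[ℝ] B × EuclideanSpace ℝ (Fin d)) = (fderiv ℝ h p).prod ψ := by
    ext1 x; rfl
  -- Restricting to the open set where DΨ is invertible makes the local inverse smooth on its whole
  -- target, not just at the image of p.
  let O : Set A := fderiv ℝ Ψ ⁻¹'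
    Set.range ((↑) : (A ≃L[ℝ] B × EuclideanSpace ℝ (Fin d)) → A →L[ℝ] B × EuclideanSpace ℝ (Fin d))
  have hO : IsOpen O := ContinuousLinearEquiv.isOpen.preimage (hΨ.continuous_fderiv (by simp))
  have hpO : p ∈ O := ⟨T, by rw [hT, (hΨ' p).fderiv]⟩
  have hTd : HasFDerivAt Ψ (T : A →L[ℝ] B × EuclideanSpace ℝ (Fin d)) p := hT ▸ hΨ' p
  let Φ := (hΨ.contDiffAt.toOpenPartialHomeomorph Ψ hTd (by simp)).restrOpen O hO
  have hΦ : ∀ x, Φ x = Ψ x := fun x => rfl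
  have hpΦ : p ∈ Φ.source :=
    ⟨hΨ.contDiffAt.mem_toOpenPartialHomeomorph_source hTd (by simp), hpO⟩
  have hsymm : ∀ y ∈ Φ.target, ContDiffAt ℝ ∞ Φ.symm y := by
    intro y hy
    have hx := Φ.map_target hy
    obtain ⟨T', hT'⟩ : Φ.symm y ∈ O := hx.2
    refine Φ.contDiffAt_symm (f₀' := T') hy ?_ hΨ.contDiffAt
    rw [hT']
    exact (hΨ' _).differentiableAt.hasFDerivAt
  let ι : EuclideanSpace ℝ (Fin d) → B × EuclideanSpace ℝ (Fin d) := fun u => (c, u)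
  have hι : ContDiff ℝ ∞ ι := contDiff_const.prodMk contDiff_id
  have hV : IsOpen (ι ⁻¹' Φ.target) := Φ.open_target.preimage hι.continuous
  have hφ : ∀ u ∈ ι ⁻¹' Φ.target, ContDiffAt ℝ ∞ (fun u => Φ.symm (ι u)) u := fun u hu =>
    (hsymm _ hu).comp u hι.contDiffAt
  have hr : ∀ u ∈ ι ⁻¹' Φ.target, Ψ (Φ.symm (ι u)) = ι u := fun u hu => Φ.right_inv hu
  refine ⟨ι ⁻¹' Φ.target, fun u => Φ.symm (ι u), Φ.source, ψ, ⟨hV, ?_, ?_, ?_⟩, Φ.open_source,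
    hpΦ, ?_, ψ.continuous.continuousOn, ?_⟩
  · exact fun u hu => (hφ u hu).contDiffWithinAt
  · intro u hu
    have h1 : HasFDerivAt (fun u => ψ (Φ.symm (ι u)))
        (ψ.comp (fderiv ℝ (fun u => Φ.symm (ι u)) u)) u :=
      ψ.hasFDerivAt.comp u ((hφ u hu).differentiableAt (by simp)).hasFDerivAt
    have h2 : (fun u => ψ (Φ.symm (ι u))) =ᶠ[nhds u] id := by
      filter_upwards [hV.mem_nhds hu] with v hv
      exact congrArg Prod.snd (hr v hv)
    have h3 := h1.unique ((hasFDerivAt_id u).congr_of_eventuallyEq h2)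
    -- Near u the chart ψ inverts the parametrization, so its derivative has a left inverse.
    intro v w hvw
    have h4 := congrArg ψ hvw
    simpa using (congrArg (fun T : EuclideanSpace ℝ (Fin d) →L[ℝ] EuclideanSpace ℝ (Fin d) => T v)
      h3).symm.trans (h4.trans (congrArg
        (fun T : EuclideanSpace ℝ (Fin d) →L[ℝ] EuclideanSpace ℝ (Fin d) => T w) h3))
  · exact fun u hu => congrArg Prod.fst (hr u hu)
  · ext x
    constructor
    · rintro ⟨u, hu, rfl⟩
      exact ⟨congrArg Prod.fst (hr u hu), Φ.map_target hu⟩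
    · rintro ⟨hx, hxs⟩
      have hxι : ι (ψ x) = Φ x := by
        rw [hΦ]; exact Prod.ext (Eq.symm hx) rfl
      refine ⟨ψ x, ?_, ?_⟩
      · change ι (ψ x) ∈ Φ.target
        rw [hxι]; exact Φ.map_source hxs
      · change Φ.symm (ι (ψ x)) = x
        rw [hxι]; exact Φ.left_inv hxs
  · exact fun u hu => congrArg Prod.snd (hr u hu)

/-- The tangent space of a regular level set is the kernel of the differential. -/
theorem IsLocalParametrization.exists_fderiv_eq {h : A → B} (hh : ContDiff ℝ ∞ h) {c : B}
    (hsurj : ∀ p, h p = c → Function.Surjective (fderiv ℝ h p))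
    (hd : finrank ℝ A = d + finrank ℝ B)
    {V : Set (EuclideanSpace ℝ (Fin d))} {φ : EuclideanSpace ℝ (Fin d) → A}
    (hφ : IsLocalParametrization d (h ⁻¹' {c}) V φ) {u : EuclideanSpace ℝ (Fin d)} (hu : u ∈ V)
    {z : A} (hz : fderiv ℝ h (φ u) z = 0) : ∃ v, fderiv ℝ φ u v = z := by
  have h1 : LinearMap.range (fderiv ℝ φ u).toLinearMap =
      LinearMap.ker (fderiv ℝ h (φ u)).toLinearMap := by
    apply Submodule.eq_of_le_of_finrank_eq
    · rintro _ ⟨v, rfl⟩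
      exact hφ.fderiv_levelSet_eq_zero hh hu v
    · rw [finrank_ker_of_surjective (hsurj _ (hφ.mapsTo hu)) hd,
        LinearMap.finrank_range_of_inj (hφ.injective_fderiv u hu)]
      simp
  have h2 : z ∈ LinearMap.ker (fderiv ℝ h (φ u)).toLinearMap := hz
  rw [← h1] at h2
  exact h2

variable [FiniteDimensional ℝ B]

/-- A point of a level set at which no nonzero tangent vector is annihilated is regular. -/
theorem mem_regularPoints_levelSet {h : A → B} (hh : ContDiff ℝ ∞ h) {c : B}
    (hsurj : ∀ p, h p = c → Function.Surjective (fderiv ℝ h p))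
    (hd : finrank ℝ A = d + finrank ℝ B) {F : A → E} (hF : ContDiff ℝ ∞ F) {p : A} (hp : h p = c)
    (hinj : ∀ z, fderiv ℝ h p z = 0 → fderiv ℝ F p z = 0 → z = 0) :
    p ∈ regularPoints d (h ⁻¹' {c}) F := by
  obtain ⟨V, φ, W, ψ, hφ, hW, hpW, himg, -, -⟩ :=
    isEmbeddedSubmanifold_levelSet hh c hsurj hd p hp
  obtain ⟨u, hu, rfl⟩ : p ∈ φ '' V := himg ▸ ⟨hp, hpW⟩
  refine ⟨V, φ, hφ, u, hu, rfl, ?_⟩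
  rw [fderiv_comp u (hF.differentiable (by simp) _)
    ((hφ.contDiffOn.contDiffAt (hφ.isOpen.mem_nhds hu)).differentiableAt (by simp))]
  refine (injective_iff_map_eq_zero _).mpr fun v hv => ?_
  refine (injective_iff_map_eq_zero _).mp (hφ.injective_fderiv u hu) v ?_
  exact hinj _ (hφ.fderiv_levelSet_eq_zero hh hu v) hv

/-- Let `F` be a smooth map on a regular level set such that for every regular point `p` there is an
isometry `R` of the target which comes from a symmetry of the level set fixing `p` and such that
`1 + R` maps into the tangent space (so that `R = -1` on the normal space). If the regular
points are dense, `F` parametrizes a minimal submanifold. -/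
theorem isMinimalSubmanifoldWith_levelSet {h : A → B} (hh : ContDiff ℝ ∞ h) {c : B}
    (hsurj : ∀ p, h p = c → Function.Surjective (fderiv ℝ h p))
    (hd : finrank ℝ A = d + finrank ℝ B) {F : A → E} (hF : ContDiff ℝ ∞ F) {S : Set E}
    (hS : F '' (h ⁻¹' {c}) = S)
    (hdense : ∀ p, h p = c → p ∈ closure {q | h q = c ∧
      ∀ z, fderiv ℝ h q z = 0 → fderiv ℝ F q z = 0 → z = 0})
    (hsymm : ∀ p, h p = c → (∀ z, fderiv ℝ h p z = 0 → fderiv ℝ F p z = 0 → z = 0) →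
      ∃ (s : A →L[ℝ] A) (σ : B →L[ℝ] B) (R : E →L[ℝ] E),
        (∀ z, h (p + s z) - h p = σ (h (p + z) - h p)) ∧
        (∀ z, F (p + s z) - F p = R (F (p + z) - F p)) ∧
        (∀ x y, inner ℝ (R x) (R y) = inner ℝ x y) ∧
        ∀ x, ∃ z, fderiv ℝ h p z = 0 ∧ fderiv ℝ F p z = x + R x) :
    IsMinimalSubmanifoldWith d (h ⁻¹' {c}) F S := by
  refine ⟨hS, hF, isEmbeddedSubmanifold_levelSet hh c hsurj hd, fun p hp => ?_, ?_⟩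
  · exact closure_mono (fun q hq => mem_regularPoints_levelSet hh hsurj hd hF hq.1 hq.2)
      (hdense p hp)
  intro V φ hφ u hu hinj
  have hφ2 : ContDiffAt ℝ 2 φ u :=
    (hφ.contDiffOn.contDiffAt (hφ.isOpen.mem_nhds hu)).of_le (by norm_cast)
  have hF2 : ContDiff ℝ 2 F := hF.of_le (by norm_cast)
  have hh2 : ContDiff ℝ 2 h := hh.of_le (by norm_cast)
  have hG : ∀ v, fderiv ℝ (F ∘ φ) u v = fderiv ℝ F (φ u) (fderiv ℝ φ u v) := fun v => by
    rw [fderiv_comp u (hF2.differentiable (by norm_num) _) (hφ2.differentiableAt (by norm_num))]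
    rfl
  have htan : ∀ z, fderiv ℝ h (φ u) z = 0 → ∃ v, fderiv ℝ φ u v = z := fun z hz =>
    hφ.exists_fderiv_eq hh hsurj hd hu hz
  have hker := hφ.fderiv_levelSet_eq_zero hh hu
  obtain ⟨s, σ, R, hhs, hFs, hR, hRx⟩ := hsymm (φ u) (hφ.mapsTo hu) (by
    intro z hz hFz
    obtain ⟨v, rfl⟩ := htan z hz
    rw [← hG] at hFz
    rw [(injective_iff_map_eq_zero _).mp hinj v hFz, map_zero])
  have hsh : ∀ z, fderiv ℝ h (φ u) (s z) = σ (fderiv ℝ h (φ u) z) := fun z => by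
    simpa using fderiv_intertwine hh2 hhs 0 z
  have hsF : ∀ z, fderiv ℝ F (φ u) (s z) = R (fderiv ℝ F (φ u) z) := fun z => by
    simpa using fderiv_intertwine hF2 hFs 0 z
  obtain ⟨g, hg⟩ := LinearMap.exists_leftInverse_of_injective (fderiv ℝ φ u).toLinearMap
    (LinearMap.ker_eq_bot.mpr (hφ.injective_fderiv u hu))
  -- `T` is `s` read in the parameters. The choice of left inverse `g` is immaterial, because `s`
  -- preserves the kernel of Dh, which is the range of Dφ.
  set T : EuclideanSpace ℝ (Fin d) →ₗ[ℝ] EuclideanSpace ℝ (Fin d) :=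
    g ∘ₗ s.toLinearMap ∘ₗ (fderiv ℝ φ u).toLinearMap with hT
  have hTs : ∀ v, fderiv ℝ φ u (T v) = s (fderiv ℝ φ u v) := by
    intro v
    obtain ⟨w, hw⟩ := htan (s (fderiv ℝ φ u v)) (by rw [hsh, hker, map_zero])
    have h1 : T v = w := by
      have := congrArg (fun T : EuclideanSpace ℝ (Fin d) →ₗ[ℝ] EuclideanSpace ℝ (Fin d) => T w) hg
      simp only [LinearMap.comp_apply, ContinuousLinearMap.coe_coe, hw, LinearMap.id_apply] at this
      simpa [hT] using this
    rw [h1, hw]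
  -- This is the second derivative of the locally constant map h ∘ φ.
  have hhzero : ∀ v w, fderiv ℝ (fun x => fderiv ℝ h x) (φ u) (fderiv ℝ φ u v) (fderiv ℝ φ u w) +
      fderiv ℝ h (φ u) (fderiv ℝ (fun x => fderiv ℝ φ x) u v w) = 0 := by
    intro v w
    rw [← fderiv_fderiv_comp hh2 hφ2]
    have h1 : (fun x => fderiv ℝ (h ∘ φ) x) =ᶠ[nhds u] fun _ => 0 := by
      filter_upwards [hφ.isOpen.mem_nhds hu] with x hx
      have h2 : h ∘ φ =ᶠ[nhds x] fun _ => c := by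
        filter_upwards [hφ.isOpen.mem_nhds hx] with y hy
        exact hφ.mapsTo hy
      rw [h2.fderiv_eq]
      simp
    rw [h1.fderiv_eq]
    simp
  refine meanCurvatureVector_eq_zero_of_neg hinj T (fun v w => ?_) fun v w => ?_
  · simp only [hG, hTs, hsF, hR]
  rw [eq_neg_iff_add_eq_zero, secondFundamentalForm, secondFundamentalForm, ← map_add,
    Submodule.starProjection_apply_eq_zero_iff]
  -- It remains to see that the sum of the two second derivatives is tangent.
  refine Submodule.le_orthogonal_orthogonal _ ?_
  have hmem : ∀ z, fderiv ℝ h (φ u) z = 0 →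
      fderiv ℝ F (φ u) z ∈ LinearMap.range (fderiv ℝ (F ∘ φ) u).toLinearMap := by
    intro z hz
    obtain ⟨v, rfl⟩ := htan z hz
    exact ⟨v, hG v⟩
  set X := fderiv ℝ (fun x => fderiv ℝ (F ∘ φ) x) u v w with hX
  obtain ⟨z, hz, hzX⟩ := hRx X
  -- The parametrization need not respect the symmetry; `k` measures the failure at second order. It
  -- is tangent by `hhzero`, so the second derivative at (T v, T w) is R X up to the tangent vector
  -- DF(k), and X + R X is tangent by hypothesis.
  set k := fderiv ℝ (fun x => fderiv ℝ φ x) u (T v) (T w) -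
    s (fderiv ℝ (fun x => fderiv ℝ φ x) u v w) with hk
  have hk0 : fderiv ℝ h (φ u) k = 0 := by
    have h1 := hhzero (T v) (T w)
    rw [hTs, hTs, fderiv_fderiv_intertwine hh2 hhs] at h1
    have h2 := congrArg σ (hhzero v w)
    rw [map_add, map_zero] at h2
    rw [hk, map_sub, hsh, sub_eq_zero]
    exact add_left_cancel (h1.trans h2.symm)
  have hfin : fderiv ℝ (fun x => fderiv ℝ (F ∘ φ) x) u (T v) (T w) + X =
      fderiv ℝ F (φ u) z + fderiv ℝ F (φ u) k := by
    rw [hzX, hX, fderiv_fderiv_comp hF2 hφ2, fderiv_fderiv_comp hF2 hφ2, hTs, hTs,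
      fderiv_fderiv_intertwine hF2 hFs, hk, map_sub, hsF, map_add]
    abel
  rw [hfin]
  exact Submodule.add_mem _ (hmem z hz) (hmem k hk0)

end LevelSets

/-! ### Real coordinates on the complex blocks -/

section Blocks

variable {L N : ℕ}

/-- The real coordinates of `L` blocks of `N + 1` complex coordinates. -/
abbrev RealBlocks (L N : ℕ) : Type :=
  Fin L → EuclideanSpace ℝ (Fin (N + 1)) × EuclideanSpace ℝ (Fin (N + 1))

/-- The real-linear map `(X_t, Y_t)_t ↦ (a_t (X_t + i Y_t))_t`. -/
def ofRealBlocks (a : Fin L → ℂ) : RealBlocks L N →ₗ[ℝ] ComplexBlocks L N where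
  toFun u := WithLp.toLp 2 fun tk : Fin L × Fin (N + 1) =>
    a tk.1 * (((u tk.1).1 tk.2 : ℂ) + Complex.I * ((u tk.1).2 tk.2 : ℂ))
  map_add' u v := by
    ext tk
    simp
    ring
  map_smul' c u := by
    ext tk
    simp
    ring

/-- The inverse of `ofRealBlocks a`, for `a_t` of modulus one. -/
def toRealBlocks (a : Fin L → ℂ) : ComplexBlocks L N →ₗ[ℝ] RealBlocks L N where
  toFun q t := (WithLp.toLp 2 fun k => (starRingEnd ℂ (a t) * q (t, k)).re,
    WithLp.toLp 2 fun k => (starRingEnd ℂ (a t) * q (t, k)).im)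
  map_add' u v := by
    ext t k <;> simp <;> ring
  map_smul' c u := by
    ext t k <;> simp <;> ring

theorem ofRealBlocks_apply (a : Fin L → ℂ) (u : RealBlocks L N) (tk : Fin L × Fin (N + 1)) :
    ofRealBlocks a u tk =
      a tk.1 * (((u tk.1).1 tk.2 : ℂ) + Complex.I * ((u tk.1).2 tk.2 : ℂ)) := rfl

theorem ofRealBlocks_toRealBlocks {a : Fin L → ℂ} (ha : ∀ t, a t * starRingEnd ℂ (a t) = 1)
    (q : ComplexBlocks L N) : ofRealBlocks a (toRealBlocks a q) = q := by
  ext tk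
  rw [ofRealBlocks_apply]
  simp only [toRealBlocks, LinearMap.coe_mk, AddHom.coe_mk]
  rw [mul_comm Complex.I, Complex.re_add_im, ← mul_assoc, ha, one_mul]

theorem toRealBlocks_ofRealBlocks {a : Fin L → ℂ} (ha : ∀ t, a t * starRingEnd ℂ (a t) = 1)
    (u : RealBlocks L N) : toRealBlocks a (ofRealBlocks a u) = u := by
  have h : ∀ t k, starRingEnd ℂ (a t) * ofRealBlocks a u (t, k) =
      ((u t).1 k : ℂ) + Complex.I * ((u t).2 k : ℂ) := fun t k => by
    rw [ofRealBlocks_apply, ← mul_assoc, mul_comm (starRingEnd ℂ (a t)), ha, one_mul]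
  ext t k
  · change (starRingEnd ℂ (a t) * ofRealBlocks a u (t, k)).re = _
    rw [h]; simp
  · change (starRingEnd ℂ (a t) * ofRealBlocks a u (t, k)).im = _
    rw [h]; simp

/-- Unit factors cancel against their conjugates. Hence isometries may be checked in the rotated
real coordinates. -/
theorem inner_ofRealBlocks {a : Fin L → ℂ} (ha : ∀ t, a t * starRingEnd ℂ (a t) = 1)
    (u v : RealBlocks L N) : inner ℝ (ofRealBlocks a u) (ofRealBlocks a v) =
      ∑ t, (inner ℝ (u t).1 (v t).1 + inner ℝ (u t).2 (v t).2) := by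
  rw [PiLp.inner_apply, Fintype.sum_prod_type]
  refine Finset.sum_congr rfl fun t _ => ?_
  rw [PiLp.inner_apply, PiLp.inner_apply, ← Finset.sum_add_distrib]
  refine Finset.sum_congr rfl fun k _ => ?_
  rw [ofRealBlocks_apply, ofRealBlocks_apply, Complex.inner]
  have h : a t * (((v t).1 k : ℂ) + Complex.I * ((v t).2 k : ℂ)) *
      starRingEnd ℂ (a t * (((u t).1 k : ℂ) + Complex.I * ((u t).2 k : ℂ))) =
      (((v t).1 k : ℂ) + Complex.I * ((v t).2 k : ℂ)) *
        starRingEnd ℂ (((u t).1 k : ℂ) + Complex.I * ((u t).2 k : ℂ)) := by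
    rw [map_mul]
    linear_combination starRingEnd ℂ (((u t).1 k : ℂ) + Complex.I * ((u t).2 k : ℂ)) *
        (((v t).1 k : ℂ) + Complex.I * ((v t).2 k : ℂ)) * ha t
  rw [h]
  simp

/-- The map `(X_t, Y_t)_t ↦ (ρ_t Y_t, ρ_t X_t)_t`. -/
def swapBlocks (ρ : Fin L → EuclideanSpace ℝ (Fin (N + 1)) ≃ₗᵢ[ℝ] EuclideanSpace ℝ (Fin (N + 1))) :
    RealBlocks L N →ₗ[ℝ] RealBlocks L N where
  toFun u t := (ρ t (u t).2, ρ t (u t).1)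
  map_add' u v := by
    ext t k <;> simp
  map_smul' c u := by
    ext t k <;> simp

theorem swapBlocks_apply
    (ρ : Fin L → EuclideanSpace ℝ (Fin (N + 1)) ≃ₗᵢ[ℝ] EuclideanSpace ℝ (Fin (N + 1)))
    (u : RealBlocks L N) (t : Fin L) : swapBlocks ρ u t = (ρ t (u t).2, ρ t (u t).1) := rfl

end Blocks

/-! ### Derivatives of the helicoid maps and of the torus equations -/

section Maps

variable {L N : ℕ} (Λ : Fin (L + 1) → ℝ)

/-- The unit complex numbers `e^{i λ_t Θ}`. -/
def phase (Θ : ℝ) (t : Fin L) : ℂ := Complex.exp (Complex.I * ((Λ t.succ * Θ : ℝ) : ℂ))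

theorem phase_mul_conj (Θ : ℝ) (t : Fin L) : phase Λ Θ t * starRingEnd ℂ (phase Λ Θ t) = 1 := by
  rw [phase, ← Complex.exp_conj, ← Complex.exp_add]
  simp

theorem phase_add (Θ θ : ℝ) (t : Fin L) : phase Λ (Θ + θ) t = phase Λ Θ t *
    ((Real.cos (Λ t.succ * θ) : ℂ) + Complex.I * (Real.sin (Λ t.succ * θ) : ℂ)) := by
  rw [phase, phase, mul_add, Complex.ofReal_add, mul_add, Complex.exp_add,
    mul_comm Complex.I ((Λ t.succ * θ : ℝ) : ℂ), Complex.exp_mul_I]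
  push_cast
  ring

theorem helicoidConeMap_apply (p : HelicoidParam L N) (tk : Fin L × Fin (N + 1)) :
    helicoidConeMap N Λ p tk = (p.2.2 tk.1 : ℂ) * phase Λ p.2.1 tk.1 *
      (((p.1 tk.1).1 tk.2 : ℂ) + Complex.I * ((p.1 tk.1).2 tk.2 : ℂ)) := rfl

/-- The cone map in the frame rotated by `e^{i λ_t Θ}`. -/
theorem helicoidConeMap_add (Θ : ℝ) (q : HelicoidParam L N) (θ : ℝ) (hq : q.2.1 = Θ + θ) :
    helicoidConeMap N Λ q = ofRealBlocks (phase Λ Θ) fun t =>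
      (q.2.2 t • (Real.cos (Λ t.succ * θ) • (q.1 t).1 - Real.sin (Λ t.succ * θ) • (q.1 t).2),
        q.2.2 t • (Real.sin (Λ t.succ * θ) • (q.1 t).1 + Real.cos (Λ t.succ * θ) • (q.1 t).2)) := by
  ext tk
  rw [helicoidConeMap_apply, ofRealBlocks_apply, hq, phase_add]
  simp only [PiLp.smul_apply, PiLp.sub_apply, PiLp.add_apply, smul_eq_mul]
  push_cast
  linear_combination (q.2.2 tk.1 : ℂ) * phase Λ Θ tk.1 * Complex.sin (Λ tk.1.succ * θ) *
    ((q.1 tk.1).2 tk.2 : ℂ) * Complex.I_sq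

theorem contDiff_helicoidConeMap : ContDiff ℝ ∞ (helicoidConeMap (L := L) N Λ) := by
  rw [contDiff_piLp]
  intro tk
  have h1 : ContDiff ℝ ∞ fun p : HelicoidParam L N => p.1 tk.1 := by fun_prop
  have h2 : ContDiff ℝ ∞ fun p : HelicoidParam L N => (p.1 tk.1).1 tk.2 :=
    (contDiff_piLp 2).mp h1.fst tk.2
  have h3 : ContDiff ℝ ∞ fun p : HelicoidParam L N => (p.1 tk.1).2 tk.2 :=
    (contDiff_piLp 2).mp h1.snd tk.2
  have h4 : ContDiff ℝ ∞ fun p : HelicoidParam L N => p.2.2 tk.1 := by fun_prop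
  have h5 : ContDiff ℝ ∞ fun p : HelicoidParam L N => Λ tk.1.succ * p.2.1 := by fun_prop
  have c := Complex.ofRealCLM.contDiff (n := ∞)
  exact ((c.comp h4).mul (contDiff_const.mul (c.comp h5)).cexp).mul
    ((c.comp h2).add (contDiff_const.mul (c.comp h3)))

theorem contDiff_helicoidMap : ContDiff ℝ ∞ (helicoidMap (L := L) N Λ) :=
  WithLp.contDiff_toLp.comp ((contDiff_helicoidConeMap Λ).prodMk
    (contDiff_const.mul contDiff_snd.fst))

/-- Reduces the explicit differentials below to one-variable calculus along lines. -/
theorem fderiv_apply_eq_of_line {A E : Type*} [NormedAddCommGroup A] [NormedSpace ℝ A]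
    [NormedAddCommGroup E] [NormedSpace ℝ E] {f : A → E} {p z : A} {f' : E}
    (hf : DifferentiableAt ℝ f p) (h : HasDerivAt (fun s : ℝ => f (p + s • z)) f' 0) :
    fderiv ℝ f p z = f' := by
  rw [← hf.lineDeriv_eq_fderiv]
  exact HasLineDerivAt.lineDeriv h

theorem fderiv_helicoidConeMap (p z : HelicoidParam L N) :
    fderiv ℝ (helicoidConeMap N Λ) p z = ofRealBlocks (phase Λ p.2.1) fun t =>
      (z.2.2 t • (p.1 t).1 + p.2.2 t • (z.1 t).1 - (Λ t.succ * z.2.1 * p.2.2 t) • (p.1 t).2,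
        z.2.2 t • (p.1 t).2 + p.2.2 t • (z.1 t).2 + (Λ t.succ * z.2.1 * p.2.2 t) • (p.1 t).1) := by
  have hd := (contDiff_helicoidConeMap (N := N) Λ).differentiable (by simp) p
  ext tk
  have h0 : (fderiv ℝ (helicoidConeMap N Λ) p z) tk =
      fderiv ℝ (fun q => helicoidConeMap N Λ q tk) p z := by
    have := (PiLp.proj (𝕜 := ℝ) 2 (fun _ : Fin L × Fin (N + 1) => ℂ) tk).hasFDerivAt.comp p
      hd.hasFDerivAt
    exact congrArg (fun T : HelicoidParam L N →L[ℝ] ℂ => T z) this.fderiv.symm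
  have hd' : DifferentiableAt ℝ (fun q => helicoidConeMap N Λ q tk) p :=
    ((contDiff_piLp 2).mp (contDiff_helicoidConeMap (N := N) Λ) tk).differentiable (by simp) p
  rw [h0]
  apply fderiv_apply_eq_of_line hd'
  have hl : ∀ a b : ℝ, HasDerivAt (fun s : ℝ => a + s * b) b 0 := fun a b => by
    simpa using ((hasDerivAt_id (0 : ℝ)).mul_const b).const_add a
  have h1 := (hl (p.2.2 tk.1) (z.2.2 tk.1)).ofReal_comp
  have h2 := (((hl p.2.1 z.2.1).const_mul (Λ tk.1.succ)).ofReal_comp.const_mul Complex.I).cexp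
  have h3 := (hl ((p.1 tk.1).1 tk.2) ((z.1 tk.1).1 tk.2)).ofReal_comp
  have h4 := (hl ((p.1 tk.1).2 tk.2) ((z.1 tk.1).2 tk.2)).ofReal_comp.const_mul Complex.I
  have h5 := (h1.mul h2).mul (h3.add h4)
  refine HasDerivAt.congr_deriv h5 ?_
  rw [ofRealBlocks_apply, phase]
  simp only [PiLp.smul_apply, PiLp.sub_apply, PiLp.add_apply, smul_eq_mul, zero_mul, add_zero,
    Pi.add_apply, Pi.mul_apply]
  push_cast
  linear_combination (Λ tk.1.succ * z.2.1 * p.2.2 tk.1 * (p.1 tk.1).2 tk.2 : ℂ) *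
    Complex.exp (Complex.I * (Λ tk.1.succ * p.2.1)) * Complex.I_sq

theorem fderiv_helicoidMap (p z : HelicoidParam L N) :
    fderiv ℝ (helicoidMap N Λ) p z =
      WithLp.toLp 2 (fderiv ℝ (helicoidConeMap N Λ) p z, Λ 0 * z.2.1) := by
  have hd := (contDiff_helicoidConeMap (N := N) Λ).differentiable (by simp) p
  have h1 : HasFDerivAt (fun q : HelicoidParam L N => Λ 0 * q.2.1)
      (Λ 0 • (ContinuousLinearMap.fst ℝ ℝ (Fin L → ℝ)).comp
        (ContinuousLinearMap.snd ℝ (RealBlocks L N) (ℝ × (Fin L → ℝ)))) p :=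
    ((ContinuousLinearMap.fst ℝ ℝ (Fin L → ℝ)).comp
      (ContinuousLinearMap.snd ℝ (RealBlocks L N) (ℝ × (Fin L → ℝ)))).hasFDerivAt.const_mul (Λ 0)
  have h2 := (WithLp.prodContinuousLinearEquiv 2 ℝ (ComplexBlocks L N) ℝ).symm.hasFDerivAt.comp p
    (hd.hasFDerivAt.prodMk h1)
  exact congrArg (fun T : HelicoidParam L N →L[ℝ] HelicoidSpace L N => T z) h2.fderiv

/-- The functions `‖X_t‖²`, `‖Y_t‖²` defining the product of Clifford tori. -/
def torusConstraint (p : HelicoidParam L N) : Fin L → ℝ × ℝ :=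
  fun t => (‖(p.1 t).1‖ ^ 2, ‖(p.1 t).2‖ ^ 2)

theorem contDiff_torusConstraint : ContDiff ℝ ∞ (torusConstraint (L := L) (N := N)) := by
  refine contDiff_pi.mpr fun t => ?_
  have h : ContDiff ℝ ∞ fun p : HelicoidParam L N => p.1 t := by fun_prop
  exact (h.fst.norm_sq ℝ).prodMk (h.snd.norm_sq ℝ)

theorem fderiv_torusConstraint (p z : HelicoidParam L N) :
    fderiv ℝ torusConstraint p z =
      fun t => (2 * inner ℝ (p.1 t).1 (z.1 t).1, 2 * inner ℝ (p.1 t).2 (z.1 t).2) := by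
  apply fderiv_apply_eq_of_line (contDiff_torusConstraint.differentiable (by simp) p)
  refine hasDerivAt_pi.mpr fun t => ?_
  have hl : ∀ a b : EuclideanSpace ℝ (Fin (N + 1)),
      HasDerivAt (fun s : ℝ => ‖a + s • b‖ ^ 2) (2 * inner ℝ a b) 0 := fun a b => by
    have h1 : HasDerivAt (fun s : ℝ => a + s • b) b 0 := by
      simpa using ((hasDerivAt_id (0 : ℝ)).smul_const b).const_add a
    simpa using h1.norm_sq
  exact (hl _ _).prodMk (hl _ _)

theorem fderiv_torusConstraint_eq_zero_iff {p z : HelicoidParam L N} :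
    fderiv ℝ torusConstraint p z = 0 ↔
      ∀ t, inner ℝ (p.1 t).1 (z.1 t).1 = 0 ∧ inner ℝ (p.1 t).2 (z.1 t).2 = 0 := by
  rw [fderiv_torusConstraint, funext_iff]
  simp

theorem torusConstraint_eq_iff {p : HelicoidParam L N} :
    torusConstraint p = (fun _ => (1 / 2, 1 / 2)) ↔ ∀ t, p.1 t ∈ cliffordTorus N := by
  have h : ∀ x : EuclideanSpace ℝ (Fin (N + 1)), ‖x‖ ^ 2 = 1 / 2 ↔ ‖x‖ = 1 / √2 := fun x => by
    rw [← sq_eq_sq₀ (norm_nonneg x) (by positivity)]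
    simp
  simp only [funext_iff, torusConstraint, cliffordTorus, Prod.mk.injEq, Set.mem_prod,
    mem_sphere_zero_iff_norm, h]

end Maps

/-! ### The reversing symmetry, and where the maps are immersions -/

section Symmetry

variable {L N : ℕ} (Λ : Fin (L + 1) → ℝ)

/-- At `p` the map `F` on the product of Clifford tori commutes with a symmetry which fixes `p` and
reverses `Θ`, and an isometry `R` of the target such that `1 + R` maps into the image of the
tangent vectors with vanishing `Θ`-component. -/
def HasReversingSymmetry {E : Type*} [NormedAddCommGroup E] [InnerProductSpace ℝ E]
    (F : HelicoidParam L N → E) (p : HelicoidParam L N) : Prop :=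
  ∃ (s : HelicoidParam L N →L[ℝ] HelicoidParam L N) (σ : (Fin L → ℝ × ℝ) →L[ℝ] (Fin L → ℝ × ℝ))
    (R : E →L[ℝ] E),
    (∀ z, torusConstraint (p + s z) - torusConstraint p =
      σ (torusConstraint (p + z) - torusConstraint p)) ∧
    (∀ z, (s z).2.1 = -z.2.1) ∧
    (∀ z, F (p + s z) - F p = R (F (p + z) - F p)) ∧
    (∀ x y, inner ℝ (R x) (R y) = inner ℝ x y) ∧
    ∀ x, ∃ z, fderiv ℝ torusConstraint p z = 0 ∧ z.2.1 = 0 ∧ fderiv ℝ F p z = x + R x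

/-- Reflection in the hyperplane orthogonal to x - y; equal norms are exactly what makes it exchange
x and y. -/
theorem exists_isometry_swap {V : Type*} [NormedAddCommGroup V] [InnerProductSpace ℝ V]
    {x y : V} (h : ‖x‖ = ‖y‖) :
    ∃ ρ : V ≃ₗᵢ[ℝ] V, ρ x = y ∧ ρ y = x ∧ ∀ z, ρ (ρ z) = z := by
  have h1 := Submodule.reflection_sub h
  exact ⟨(ℝ ∙ (x - y))ᗮ.reflection, h1,
    (congrArg (ℝ ∙ (x - y))ᗮ.reflection h1.symm).trans (Submodule.reflection_reflection _ _),
    Submodule.reflection_reflection _⟩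

/-- The core of the argument. The hypothesis `hreg` covers discrete tori, where r_t may vanish at an
immersion point. -/
theorem hasReversingSymmetry_helicoidConeMap {p : HelicoidParam L N}
    (hp : torusConstraint p = fun _ => (1 / 2, 1 / 2))
    (hreg : ∀ t ξ, inner ℝ (p.1 t).1 ξ = 0 → p.2.2 t = 0 → ξ = 0) :
    HasReversingSymmetry (helicoidConeMap N Λ) p := by
  have hX : ∀ t, ‖(p.1 t).1‖ ^ 2 = 1 / 2 := fun t => congrArg Prod.fst (congrFun hp t)
  have hY : ∀ t, ‖(p.1 t).2‖ ^ 2 = 1 / 2 := fun t => congrArg Prod.snd (congrFun hp t)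
  have hXY : ∀ t, ‖(p.1 t).1‖ = ‖(p.1 t).2‖ := fun t =>
    (sq_eq_sq₀ (norm_nonneg _) (norm_nonneg _)).mp ((hX t).trans (hY t).symm)
  choose ρ hρX hρY hρρ using fun t => exists_isometry_swap (hXY t)
  set a := phase Λ p.2.1 with ha
  have ha1 : ∀ t, a t * starRingEnd ℂ (a t) = 1 := phase_mul_conj Λ p.2.1
  let s : HelicoidParam L N →ₗ[ℝ] HelicoidParam L N :=
    (swapBlocks ρ).prodMap ((-LinearMap.id).prodMap LinearMap.id)
  let σ : (Fin L → ℝ × ℝ) →ₗ[ℝ] (Fin L → ℝ × ℝ) :=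
    LinearMap.pi fun t => (LinearMap.snd ℝ ℝ ℝ).prod (LinearMap.fst ℝ ℝ ℝ) ∘ₗ LinearMap.proj t
  let R : ComplexBlocks L N →ₗ[ℝ] ComplexBlocks L N :=
    ofRealBlocks a ∘ₗ swapBlocks ρ ∘ₗ toRealBlocks a
  have hR : ∀ u, R (ofRealBlocks a u) = ofRealBlocks a (swapBlocks ρ u) := fun u => by
    simp only [R, LinearMap.comp_apply, toRealBlocks_ofRealBlocks ha1]
  have hs : ∀ z t, (p + s z).1 t =
      (ρ t ((p.1 t).2 + (z.1 t).2), ρ t ((p.1 t).1 + (z.1 t).1)) := fun z t => by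
    change (p.1 t + swapBlocks ρ z.1 t) = _
    rw [swapBlocks_apply, map_add, map_add, hρX, hρY]
    rfl
  -- In the frame at p the block is r (cos X - sin Y, sin X + cos Y). Replacing (X, Y, θ) by (ρ Y, ρ
  -- X, -θ) exchanges its two entries and applies ρ.
  have hRF : ∀ z, helicoidConeMap N Λ (p + s z) = R (helicoidConeMap N Λ (p + z)) := by
    intro z
    rw [helicoidConeMap_add Λ p.2.1 (p + s z) (-z.2.1) rfl,
      helicoidConeMap_add Λ p.2.1 (p + z) z.2.1 rfl, hR]
    congr 1
    ext1 t
    rw [swapBlocks_apply, hs]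
    have h1 : (p + s z).2.2 t = (p + z).2.2 t := rfl
    have h2 : (p + z).1 t = ((p.1 t).1 + (z.1 t).1, (p.1 t).2 + (z.1 t).2) := rfl
    simp only [h1, h2, mul_neg, Real.cos_neg, Real.sin_neg, map_smul, map_add, map_sub, neg_smul]
    refine Prod.ext ?_ ?_ <;> dsimp only <;> module
  refine ⟨LinearMap.toContinuousLinearMap s, LinearMap.toContinuousLinearMap σ,
    LinearMap.toContinuousLinearMap R, fun z => ?_, fun z => rfl, fun z => ?_, fun x y => ?_,
    fun x => ?_⟩
  · ext1 t
    change (‖((p + s z).1 t).1‖ ^ 2 - ‖(p.1 t).1‖ ^ 2, ‖((p + s z).1 t).2‖ ^ 2 - ‖(p.1 t).2‖ ^ 2) =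
      (‖(p.1 t).2 + (z.1 t).2‖ ^ 2 - ‖(p.1 t).2‖ ^ 2, ‖(p.1 t).1 + (z.1 t).1‖ ^ 2 - ‖(p.1 t).1‖ ^ 2)
    rw [hs, LinearIsometryEquiv.norm_map, LinearIsometryEquiv.norm_map, hXY]
  -- The point p is fixed, so R fixes its image and `hRF` passes to differences.
  · have h0 := hRF 0
    rw [map_zero, add_zero] at h0
    simp only [LinearMap.coe_toContinuousLinearMap', map_sub, hRF, ← h0]
  · rw [← ofRealBlocks_toRealBlocks ha1 x, ← ofRealBlocks_toRealBlocks ha1 y]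
    simp only [LinearMap.coe_toContinuousLinearMap', hR, inner_ofRealBlocks ha1, swapBlocks_apply,
      LinearIsometryEquiv.inner_map_map]
    exact Finset.sum_congr rfl fun t _ => add_comm _ _
  · set w := toRealBlocks a x with hw
    let m : Fin L → EuclideanSpace ℝ (Fin (N + 1)) := fun t => (w t).1 + ρ t (w t).2
    -- The factor 2 is 1 / ‖X_t‖².
    let α : Fin L → ℝ := fun t => 2 * inner ℝ (p.1 t).1 (m t)
    let ξ : Fin L → EuclideanSpace ℝ (Fin (N + 1)) := fun t => m t - α t • (p.1 t).1
    have hξ : ∀ t, inner ℝ (p.1 t).1 (ξ t) = 0 := fun t => by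
      simp only [ξ, α, inner_sub_right, inner_smul_right, real_inner_self_eq_norm_sq, hX]
      ring
    -- If r_t = 0 then ξ_t = 0 by `hreg`, so the convention 0⁻¹ = 0 is harmless.
    have hrξ : ∀ t, p.2.2 t • (p.2.2 t)⁻¹ • ξ t = ξ t := fun t => by
      by_cases hr : p.2.2 t = 0
      · rw [hreg t (ξ t) (hξ t) hr]; simp
      · exact smul_inv_smul₀ hr _
    -- With dr = α, r dX = ξ, dY = ρ dX and dΘ = 0, the image block is (α X + ξ, α Y + ρ ξ) = (m, ρ
    -- m), which is x + R x.
    refine ⟨(fun t => ((p.2.2 t)⁻¹ • ξ t, ρ t ((p.2.2 t)⁻¹ • ξ t)), 0, α), ?_, rfl, ?_⟩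
    · refine fderiv_torusConstraint_eq_zero_iff.mpr fun t => ?_
      refine ⟨by simp [inner_smul_right, hξ], ?_⟩
      dsimp only
      rw [← hρX t, LinearIsometryEquiv.inner_map_map, inner_smul_right, hξ, mul_zero]
    · rw [fderiv_helicoidConeMap, LinearMap.coe_toContinuousLinearMap',
        ← ofRealBlocks_toRealBlocks ha1 x, hR, ← ha, ← map_add]
      congr 1
      ext1 t
      rw [Pi.add_apply, swapBlocks_apply, ← hw]
      simp only [mul_zero, zero_mul, zero_smul, sub_zero, add_zero, ← map_smul, hrξ]
      refine Prod.ext ?_ ?_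
      · simp [ξ, m]
      · simp only [ξ, m, map_sub, map_add, map_smul, hρX, hρρ, Prod.snd_add]
        abel

/-- A reversing symmetry of the cone map extends to the helicoid. -/
theorem HasReversingSymmetry.helicoidMap {p : HelicoidParam L N}
    (h : HasReversingSymmetry (helicoidConeMap N Λ) p) :
    HasReversingSymmetry (helicoidMap N Λ) p := by
  obtain ⟨s, σ, R, h1, h2, h3, h4, h5⟩ := h
  let e := WithLp.prodContinuousLinearEquiv 2 ℝ (ComplexBlocks L N) ℝ
  let R' : HelicoidSpace L N →L[ℝ] HelicoidSpace L N :=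
    (e.symm : ComplexBlocks L N × ℝ →L[ℝ] HelicoidSpace L N) ∘L
      (R.prodMap (-ContinuousLinearMap.id ℝ ℝ)) ∘L
      (e : HelicoidSpace L N →L[ℝ] ComplexBlocks L N × ℝ)
  have hR' : ∀ q, R' q = WithLp.toLp 2 (R q.fst, -q.snd) := fun q => rfl
  refine ⟨s, σ, R', h1, h2, fun z => ?_, fun x y => ?_, fun x => ?_⟩
  · have hs : (p + s z).2.1 = p.2.1 - z.2.1 := by
      change p.2.1 + (s z).2.1 = _
      rw [h2]; ring
    have hz : (p + z).2.1 = p.2.1 + z.2.1 := rfl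
    rw [hR']
    refine (WithLp.ofLp_injective 2) (Prod.ext (h3 z) ?_)
    change Λ 0 * (p + s z).2.1 - Λ 0 * p.2.1 = -(Λ 0 * (p + z).2.1 - Λ 0 * p.2.1)
    rw [hs, hz]; ring
  · rw [hR', hR', WithLp.prod_inner_apply, WithLp.prod_inner_apply]
    simp only [h4, inner_neg_neg]
    rfl
  · obtain ⟨z, hz1, hz2, hz3⟩ := h5 x.fst
    refine ⟨z, hz1, hz2, ?_⟩
    rw [fderiv_helicoidMap, hz2, hz3, hR']
    refine (WithLp.ofLp_injective 2) (Prod.ext rfl ?_)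
    change Λ 0 * 0 = x.snd + -x.snd
    ring

/-- A point at which the cone map is an immersion, on tangent vectors with vanishing
`Θ`-component, has `r_t ≠ 0` unless the Clifford torus is discrete. -/
theorem eq_zero_of_radius_eq_zero {p : HelicoidParam L N}
    (hinj : ∀ z, fderiv ℝ torusConstraint p z = 0 → z.2.1 = 0 →
      fderiv ℝ (helicoidConeMap N Λ) p z = 0 → z = 0)
    (t : Fin L) (ξ : EuclideanSpace ℝ (Fin (N + 1))) (hξ : inner ℝ (p.1 t).1 ξ = 0)
    (hr : p.2.2 t = 0) : ξ = 0 := by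
  -- Moving only X_t does not change the image to first order when r_t = 0.
  have h := hinj (Pi.single t (ξ, 0), 0, 0) ?_ rfl ?_
  · have h1 := congrArg Prod.fst (congrFun (congrArg Prod.fst h) t)
    simpa using h1
  · refine fderiv_torusConstraint_eq_zero_iff.mpr fun t' => ?_
    by_cases htt : t' = t
    · subst htt; simpa using hξ
    · simp [htt]
  · rw [fderiv_helicoidConeMap, ← map_zero (ofRealBlocks (N := N) (phase Λ p.2.1))]
    congr 1
    ext1 t'
    by_cases htt : t' = t
    · subst htt; simp [hr]
    · simp [htt]

/-- The cone map is an immersion at `p` if all `r_t` are nonzero and either `Θ` is fixed or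
`λ_t ⟨X_t, Y_t⟩ ≠ 0` for some `t`. -/
theorem eq_zero_of_fderiv_helicoidConeMap_eq_zero {p z : HelicoidParam L N}
    (hp : torusConstraint p = fun _ => (1 / 2, 1 / 2)) (hr : ∀ t, p.2.2 t ≠ 0)
    (hz : fderiv ℝ torusConstraint p z = 0)
    (hF : fderiv ℝ (helicoidConeMap N Λ) p z = 0)
    (hΘ : z.2.1 = 0 ∨ ∃ t, Λ t.succ * inner ℝ (p.1 t).1 (p.1 t).2 ≠ 0) : z = 0 := by
  have hX : ∀ t, ‖(p.1 t).1‖ ^ 2 = 1 / 2 := fun t => congrArg Prod.fst (congrFun hp t)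
  have hY : ∀ t, ‖(p.1 t).2‖ ^ 2 = 1 / 2 := fun t => congrArg Prod.snd (congrFun hp t)
  have hz' := fderiv_torusConstraint_eq_zero_iff.mp hz
  rw [fderiv_helicoidConeMap] at hF
  have h0 := congrArg (toRealBlocks (phase Λ p.2.1)) hF
  rw [toRealBlocks_ofRealBlocks (phase_mul_conj Λ p.2.1), map_zero] at h0
  have h1 : ∀ t, z.2.2 t • (p.1 t).1 + p.2.2 t • (z.1 t).1 -
      (Λ t.succ * z.2.1 * p.2.2 t) • (p.1 t).2 = 0 := fun t => congrArg Prod.fst (congrFun h0 t)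
  have h2 : ∀ t, z.2.2 t • (p.1 t).2 + p.2.2 t • (z.1 t).2 +
      (Λ t.succ * z.2.1 * p.2.2 t) • (p.1 t).1 = 0 := fun t => congrArg Prod.snd (congrFun h0 t)
  have h3 : ∀ t, z.2.2 t * (1 / 2) -
      Λ t.succ * z.2.1 * p.2.2 t * inner ℝ (p.1 t).1 (p.1 t).2 = 0 := fun t => by
    have := congrArg (inner ℝ (p.1 t).1) (h1 t)
    simpa only [inner_sub_right, inner_add_right, inner_smul_right, real_inner_self_eq_norm_sq,
      hX, (hz' t).1, mul_zero, add_zero, inner_zero_right] using this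
  have h4 : ∀ t, z.2.2 t * (1 / 2) +
      Λ t.succ * z.2.1 * p.2.2 t * inner ℝ (p.1 t).1 (p.1 t).2 = 0 := fun t => by
    have := congrArg (inner ℝ (p.1 t).2) (h2 t)
    simpa only [inner_add_right, inner_smul_right, real_inner_self_eq_norm_sq,
      hY, (hz' t).2, mul_zero, add_zero, inner_zero_right, real_inner_comm (p.1 t).1 (p.1 t).2]
      using this
  -- Pairing with X_t and with Y_t gives the ⟨X_t, Y_t⟩ term opposite signs: adding kills dr_t,
  -- subtracting isolates dΘ.
  have hρ : z.2.2 = 0 := funext fun t => by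
    have := h3 t; have := h4 t; simp only [Pi.zero_apply]; linarith
  have hθ : z.2.1 = 0 := by
    rcases hΘ with h | ⟨t, ht⟩
    · exact h
    · have h5 : (p.2.2 t * (Λ t.succ * inner ℝ (p.1 t).1 (p.1 t).2)) * z.2.1 = 0 := by
        have := h3 t; have := h4 t; linarith
      exact (mul_eq_zero.mp h5).resolve_left (mul_ne_zero (hr t) ht)
  refine Prod.ext (funext fun t => Prod.ext ?_ ?_) (Prod.ext hθ hρ)
  · simpa [hθ, hρ, hr t] using h1 t
  · simpa [hθ, hρ, hr t] using h2 t

/-- Parameters with all `r_t` and all `⟨X_t, Y_t⟩` nonzero are dense, for any fixed `Θ`. -/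
theorem mem_closure_generic {p : HelicoidParam L N}
    (hp : torusConstraint p = fun _ => (1 / 2, 1 / 2)) :
    p ∈ closure {q : HelicoidParam L N | torusConstraint q = (fun _ => (1 / 2, 1 / 2)) ∧
      q.2.1 = p.2.1 ∧ (∀ t, q.2.2 t ≠ 0) ∧ ∀ t, inner ℝ (q.1 t).1 (q.1 t).2 ≠ 0} := by
  have hX : ∀ t, ‖(p.1 t).1‖ ^ 2 = 1 / 2 := fun t => congrArg Prod.fst (congrFun hp t)
  have hY : ∀ t, ‖(p.1 t).2‖ ^ 2 = 1 / 2 := fun t => congrArg Prod.snd (congrFun hp t)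
  -- Only orthogonal pairs are perturbed: rotating X_t towards Y_t keeps its norm and makes the
  -- inner product sin(s) / 2. Otherwise the rotation formula would in general leave the sphere.
  let ε : Fin L → ℝ := fun t => if inner ℝ (p.1 t).1 (p.1 t).2 = 0 then 1 else 0
  let γ : ℝ → HelicoidParam L N := fun s =>
    (fun t => (Real.cos (s * ε t) • (p.1 t).1 + Real.sin (s * ε t) • (p.1 t).2, (p.1 t).2),
      p.2.1, fun t => p.2.2 t + s)
  have hγ : Continuous γ := by fun_prop
  have hγ0 : γ 0 = p := by
    simp [γ]
  have hlim : Filter.Tendsto γ (nhdsWithin 0 (Set.Ioi 0)) (nhds p) := by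
    have := hγ.tendsto 0
    rw [hγ0] at this
    exact this.mono_left nhdsWithin_le_nhds
  refine mem_closure_of_tendsto hlim ?_
  have hr : ∀ᶠ s in nhdsWithin (0 : ℝ) (Set.Ioi 0), ∀ t, p.2.2 t + s ≠ 0 := by
    refine Filter.eventually_all.mpr fun t => ?_
    by_cases h : p.2.2 t = 0
    · filter_upwards [self_mem_nhdsWithin] with s hs
      rw [h, zero_add]
      exact ne_of_gt hs
    · have hc : Continuous fun s : ℝ => p.2.2 t + s := by fun_prop
      exact nhdsWithin_le_nhds (hc.continuousAt.eventually_ne (by simpa using h))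
  have hlt : ∀ᶠ s in nhdsWithin (0 : ℝ) (Set.Ioi 0), s < 1 :=
    nhdsWithin_le_nhds (gt_mem_nhds one_pos)
  filter_upwards [hr, hlt, self_mem_nhdsWithin] with s hs hs1 hs0
  refine ⟨funext fun t => Prod.ext ?_ (hY t), rfl, hs, fun t => ?_⟩
  · change ‖Real.cos (s * ε t) • (p.1 t).1 + Real.sin (s * ε t) • (p.1 t).2‖ ^ 2 = 1 / 2
    by_cases h : inner ℝ (p.1 t).1 (p.1 t).2 = 0
    · rw [norm_add_sq_real, norm_smul, norm_smul, mul_pow, mul_pow, hX, hY, inner_smul_left,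
        inner_smul_right, h, Real.norm_eq_abs, Real.norm_eq_abs, sq_abs, sq_abs]
      linear_combination (1 / 2) * Real.sin_sq_add_cos_sq (s * ε t)
    · simp only [ε, h, if_false, mul_zero, Real.cos_zero, Real.sin_zero, one_smul, zero_smul,
        add_zero, hX]
  · change inner ℝ (Real.cos (s * ε t) • (p.1 t).1 + Real.sin (s * ε t) • (p.1 t).2) (p.1 t).2 ≠ 0
    by_cases h : inner ℝ (p.1 t).1 (p.1 t).2 = 0
    · have hsin : 0 < Real.sin s := Real.sin_pos_of_pos_of_lt_pi hs0
        (hs1.trans (by linarith [Real.pi_gt_three]))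
      simp only [inner_add_left, inner_smul_left, h, real_inner_self_eq_norm_sq, hY, ε, if_true]
      simpa using hsin.ne'
    · simp [ε, h]

end Symmetry

/-! ### Minimality, screw invariance and the cone property -/

section Minimality

variable {L N : ℕ}

theorem exists_fderiv_torusConstraint_eq {p : HelicoidParam L N}
    (hp : torusConstraint p = fun _ => (1 / 2, 1 / 2)) (b : Fin L → ℝ × ℝ) (θ : ℝ) :
    ∃ z : HelicoidParam L N, fderiv ℝ torusConstraint p z = b ∧ z.2.1 = θ := by
  have hX : ∀ t, ‖(p.1 t).1‖ ^ 2 = 1 / 2 := fun t => congrArg Prod.fst (congrFun hp t)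
  have hY : ∀ t, ‖(p.1 t).2‖ ^ 2 = 1 / 2 := fun t => congrArg Prod.snd (congrFun hp t)
  -- Radial vectors suffice: the 2 from differentiating the square cancels ‖X_t‖² = ‖Y_t‖² = 1/2.
  refine ⟨(fun t => ((b t).1 • (p.1 t).1, (b t).2 • (p.1 t).2), θ, 0), ?_, rfl⟩
  rw [fderiv_torusConstraint]
  funext t
  simp only [inner_smul_right, real_inner_self_eq_norm_sq, hX, hY]
  refine Prod.ext ?_ ?_ <;> dsimp only <;> ring

theorem helicoidDomain_eq : helicoidDomain L N = torusConstraint ⁻¹' {fun _ => (1 / 2, 1 / 2)} := by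
  ext p
  exact torusConstraint_eq_iff.symm

/-- The equations of the product of Clifford tori together with `Θ = 0`. -/
def productConeConstraint (p : HelicoidParam L N) : (Fin L → ℝ × ℝ) × ℝ :=
  (torusConstraint p, p.2.1)

theorem productConeDomain_eq :
    productConeDomain L N = productConeConstraint ⁻¹' {(fun _ => (1 / 2, 1 / 2), 0)} := by
  ext p
  rw [Set.mem_preimage, Set.mem_singleton_iff, productConeConstraint, Prod.mk.injEq,
    torusConstraint_eq_iff]
  rfl

theorem contDiff_productConeConstraint :
    ContDiff ℝ ∞ (productConeConstraint (L := L) (N := N)) :=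
  contDiff_torusConstraint.prodMk contDiff_snd.fst

theorem fderiv_productConeConstraint (p z : HelicoidParam L N) :
    fderiv ℝ productConeConstraint p z = (fderiv ℝ torusConstraint p z, z.2.1) := by
  have h1 : HasFDerivAt (fun q : HelicoidParam L N => q.2.1)
      ((ContinuousLinearMap.fst ℝ ℝ (Fin L → ℝ)).comp
        (ContinuousLinearMap.snd ℝ (RealBlocks L N) (ℝ × (Fin L → ℝ)))) p :=
    ((ContinuousLinearMap.fst ℝ ℝ (Fin L → ℝ)).comp
      (ContinuousLinearMap.snd ℝ (RealBlocks L N) (ℝ × (Fin L → ℝ)))).hasFDerivAt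
  have h2 := (contDiff_torusConstraint.differentiable (by simp) p).hasFDerivAt.prodMk h1
  exact congrArg (fun T : HelicoidParam L N →L[ℝ] (Fin L → ℝ × ℝ) × ℝ => T z) h2.fderiv

theorem finrank_helicoidParam :
    finrank ℝ (HelicoidParam L N) = (L * (2 * N + 1) + 1) + finrank ℝ (Fin L → ℝ × ℝ) := by
  simp [Module.finrank_prod, Module.finrank_pi_fintype]
  ring

variable {E : Type*} [NormedAddCommGroup E] [InnerProductSpace ℝ E]

/-- Minimality over the whole parameter domain. -/
theorem isMinimalSubmanifoldWith_helicoidDomain {F : HelicoidParam L N → E} (hF : ContDiff ℝ ∞ F)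
    (hgen : ∀ q z, torusConstraint q = (fun _ => (1 / 2, 1 / 2)) → (∀ t, q.2.2 t ≠ 0) →
      (∀ t, inner ℝ (q.1 t).1 (q.1 t).2 ≠ 0) → fderiv ℝ torusConstraint q z = 0 →
      fderiv ℝ F q z = 0 → z = 0)
    (hsymm : ∀ p, torusConstraint p = (fun _ => (1 / 2, 1 / 2)) →
      (∀ z, fderiv ℝ torusConstraint p z = 0 → z.2.1 = 0 → fderiv ℝ F p z = 0 → z = 0) →
      HasReversingSymmetry F p) :
    IsMinimalSubmanifoldWith (L * (2 * N + 1) + 1) (helicoidDomain L N) F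
      (F '' helicoidDomain L N) := by
  rw [helicoidDomain_eq]
  refine isMinimalSubmanifoldWith_levelSet contDiff_torusConstraint (fun p hp b => ?_)
    finrank_helicoidParam hF rfl (fun p hp => ?_) fun p hp hinj => ?_
  · obtain ⟨z, hz, -⟩ := exists_fderiv_torusConstraint_eq hp b 0
    exact ⟨z, hz⟩
  · refine closure_mono ?_ (mem_closure_generic hp)
    exact fun q hq => ⟨hq.1, fun z => hgen q z hq.1 hq.2.2.1 hq.2.2.2⟩
  · obtain ⟨s, σ, R, h1, -, h3, h4, h5⟩ := hsymm p hp fun z hz _ => hinj z hz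
    exact ⟨s, σ, R, h1, h3, h4, fun x => (h5 x).imp fun z hz => ⟨hz.1, hz.2.2⟩⟩

/-- Minimality over the parameter domain `Θ = 0`. -/
theorem isMinimalSubmanifoldWith_productConeDomain {F : HelicoidParam L N → E}
    (hF : ContDiff ℝ ∞ F)
    (hgen : ∀ q z, torusConstraint q = (fun _ => (1 / 2, 1 / 2)) → (∀ t, q.2.2 t ≠ 0) →
      fderiv ℝ torusConstraint q z = 0 → z.2.1 = 0 → fderiv ℝ F q z = 0 → z = 0)
    (hsymm : ∀ p, torusConstraint p = (fun _ => (1 / 2, 1 / 2)) →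
      (∀ z, fderiv ℝ torusConstraint p z = 0 → z.2.1 = 0 → fderiv ℝ F p z = 0 → z = 0) →
      HasReversingSymmetry F p) :
    IsMinimalSubmanifoldWith (L * (2 * N + 1)) (productConeDomain L N) F
      (F '' productConeDomain L N) := by
  rw [productConeDomain_eq]
  have hker : ∀ p z : HelicoidParam L N, fderiv ℝ productConeConstraint p z = 0 ↔
      fderiv ℝ torusConstraint p z = 0 ∧ z.2.1 = 0 := fun p z => by
    rw [fderiv_productConeConstraint, Prod.mk_eq_zero]
  refine isMinimalSubmanifoldWith_levelSet contDiff_productConeConstraint (fun p hp b => ?_)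
    ?_ hF rfl (fun p hp => ?_) fun p hp hinj => ?_
  · obtain ⟨z, hz, hzθ⟩ := exists_fderiv_torusConstraint_eq (congrArg Prod.fst hp) b.1 b.2
    exact ⟨z, by rw [fderiv_productConeConstraint, hz, hzθ]⟩
  · rw [finrank_helicoidParam, Module.finrank_prod, Module.finrank_self]
    ring
  · refine closure_mono ?_ (mem_closure_generic (congrArg Prod.fst hp))
    rintro q ⟨hq, hqΘ, hqr, -⟩
    refine ⟨Prod.ext hq (hqΘ.trans (congrArg Prod.snd hp)), fun z hz => ?_⟩
    obtain ⟨hz1, hz2⟩ := (hker q z).mp hz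
    exact hgen q z hq hqr hz1 hz2
  · obtain ⟨s, σ, R, h1, h2, h3, h4, h5⟩ := hsymm p (congrArg Prod.fst hp) fun z hz hzθ =>
      hinj z ((hker p z).mpr ⟨hz, hzθ⟩)
    -- The extra equation Θ = 0 is respected because `s` reverses Θ.
    refine ⟨s, σ.prodMap (-ContinuousLinearMap.id ℝ ℝ), R, fun z => Prod.ext (h1 z) ?_, h3, h4,
      fun x => (h5 x).imp fun z hz => ⟨(hker p z).mpr ⟨hz.1, hz.2.1⟩, hz.2.2⟩⟩
    change p.2.1 + (s z).2.1 - p.2.1 = -(p.2.1 + z.2.1 - p.2.1)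
    rw [h2]
    ring

variable (Λ : Fin (L + 1) → ℝ)

theorem hasReversingSymmetry_helicoidConeMap_of_injective {p : HelicoidParam L N}
    (hp : torusConstraint p = fun _ => (1 / 2, 1 / 2))
    (hinj : ∀ z, fderiv ℝ torusConstraint p z = 0 → z.2.1 = 0 →
      fderiv ℝ (helicoidConeMap N Λ) p z = 0 → z = 0) :
    HasReversingSymmetry (helicoidConeMap N Λ) p :=
  hasReversingSymmetry_helicoidConeMap Λ hp (eq_zero_of_radius_eq_zero Λ hinj)

theorem fderiv_helicoidMap_eq_zero_iff (p z : HelicoidParam L N) :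
    fderiv ℝ (helicoidMap N Λ) p z = 0 ↔
      fderiv ℝ (helicoidConeMap N Λ) p z = 0 ∧ Λ 0 * z.2.1 = 0 := by
  rw [fderiv_helicoidMap, WithLp.toLp_eq_zero, Prod.mk_eq_zero]

theorem hasReversingSymmetry_helicoidMap_of_injective {p : HelicoidParam L N}
    (hp : torusConstraint p = fun _ => (1 / 2, 1 / 2))
    (hinj : ∀ z, fderiv ℝ torusConstraint p z = 0 → z.2.1 = 0 →
      fderiv ℝ (helicoidMap N Λ) p z = 0 → z = 0) :
    HasReversingSymmetry (helicoidMap N Λ) p := by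
  refine (hasReversingSymmetry_helicoidConeMap_of_injective Λ hp fun z hz hzθ hFz => ?_).helicoidMap
  exact hinj z hz hzθ ((fderiv_helicoidMap_eq_zero_iff Λ p z).mpr ⟨hFz, by rw [hzθ, mul_zero]⟩)

theorem image_helicoidMap : helicoidMap N Λ '' helicoidDomain L N = generalizedHelicoid N Λ := by
  ext q
  constructor
  · rintro ⟨p, hp, rfl⟩
    exact ⟨fun t => (p.1 t).1, fun t => (p.1 t).2, p.2.1, p.2.2, hp, fun _ _ => rfl, rfl⟩
  · rintro ⟨X, Y, Θ, r, hXY, h1, h2⟩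
    refine ⟨(fun t => (X t, Y t), Θ, r), hXY, (WithLp.ofLp_injective 2) (Prod.ext ?_ h2.symm)⟩
    ext tk
    exact (h1 tk.1 tk.2).symm

theorem image_helicoidConeMap :
    helicoidConeMap N Λ '' helicoidDomain L N = generalizedHelicoidCone N Λ := by
  rw [generalizedHelicoidCone, ← image_helicoidMap, Set.image_image]
  rfl

theorem image_productConeDomain {M : Type*} {F : HelicoidParam L N → M}
    (hF : ∀ p : HelicoidParam L N, F (p.1, 0, p.2.2) = F p) :
    F '' productConeDomain L N = F '' helicoidDomain L N := by
  apply Set.Subset.antisymm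
  · exact Set.image_mono fun p hp => hp.1
  · rintro _ ⟨p, hp, rfl⟩
    exact ⟨(p.1, 0, p.2.2), ⟨hp, rfl⟩, hF p⟩

theorem helicoidConeMap_zero_angle (p : HelicoidParam L N) :
    helicoidConeMap N (0 : Fin (L + 1) → ℝ) (p.1, 0, p.2.2) = helicoidConeMap N 0 p := by
  ext tk
  simp [helicoidConeMap]

theorem helicoidMap_zero_angle (p : HelicoidParam L N) :
    helicoidMap N (0 : Fin (L + 1) → ℝ) (p.1, 0, p.2.2) = helicoidMap N 0 p := by
  refine (WithLp.ofLp_injective 2) (Prod.ext (helicoidConeMap_zero_angle p) ?_)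
  simp [helicoidMap]

theorem exists_succ_ne_zero {Λ : Fin (L + 1) → ℝ} (h : Λ ≠ 0) (h0 : Λ 0 = 0) :
    ∃ t : Fin L, Λ t.succ ≠ 0 := by
  by_contra! hn
  exact h (funext fun i => Fin.cases h0 hn i)

/-- The screw motion by `θ` shifts the parameter `Θ` by `θ`. -/
theorem multiScrewMotion_helicoidMap (θ : ℝ) (p : HelicoidParam L N) :
    multiScrewMotion Λ θ (helicoidMap N Λ p) = helicoidMap N Λ (p.1, p.2.1 + θ, p.2.2) := by
  refine (WithLp.ofLp_injective 2) (Prod.ext ?_ (mul_add _ _ _).symm)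
  ext tk
  change Complex.exp (Complex.I * ((Λ tk.1.succ * θ : ℝ) : ℂ)) *
    ((p.2.2 tk.1 : ℂ) * Complex.exp (Complex.I * ((Λ tk.1.succ * p.2.1 : ℝ) : ℂ)) *
      (((p.1 tk.1).1 tk.2 : ℂ) + Complex.I * ((p.1 tk.1).2 tk.2 : ℂ))) =
    (p.2.2 tk.1 : ℂ) * Complex.exp (Complex.I * ((Λ tk.1.succ * (p.2.1 + θ) : ℝ) : ℂ)) *
      (((p.1 tk.1).1 tk.2 : ℂ) + Complex.I * ((p.1 tk.1).2 tk.2 : ℂ))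
  rw [mul_add (Λ tk.1.succ), Complex.ofReal_add, mul_add Complex.I, Complex.exp_add]
  ring

theorem image_multiScrewMotion (θ : ℝ) :
    multiScrewMotion Λ θ '' generalizedHelicoid N Λ = generalizedHelicoid N Λ := by
  rw [← image_helicoidMap, Set.image_image]
  simp only [multiScrewMotion_helicoidMap]
  apply Set.Subset.antisymm
  · rintro _ ⟨p, hp, rfl⟩
    exact ⟨(p.1, p.2.1 + θ, p.2.2), hp, rfl⟩
  · rintro _ ⟨p, hp, rfl⟩
    refine ⟨(p.1, p.2.1 - θ, p.2.2), hp, ?_⟩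
    simp

theorem smul_mem_generalizedHelicoidCone (c : ℝ) {z : ComplexBlocks L N}
    (hz : z ∈ generalizedHelicoidCone N Λ) : c • z ∈ generalizedHelicoidCone N Λ := by
  rw [← image_helicoidConeMap] at hz ⊢
  obtain ⟨p, hp, rfl⟩ := hz
  -- Scaling acts on the r_t alone; since they may have any sign, every real c is allowed.
  refine ⟨(p.1, p.2.1, c • p.2.2), hp, ?_⟩
  ext tk
  simp [helicoidConeMap, mul_assoc]

end Minimality

end

/-! ### The main theorem -/

theorem theorem2 (L N : ℕ) (hL : 1 ≤ L) (Λ : Fin (L + 1) → ℝ) :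
    -- minimality in `ℝ^{L(2N+2)+1}`
    (Λ ≠ 0 → IsMinimalSubmanifoldWith (L * (2 * N + 1) + 1) (helicoidDomain L N)
      (helicoidMap N Λ) (generalizedHelicoid N Λ)) ∧
    (Λ = 0 → IsMinimalSubmanifoldWith (L * (2 * N + 1)) (productConeDomain L N)
      (helicoidMap N Λ) (generalizedHelicoid N Λ)) ∧
    -- invariance under the multi-screw motion
    (∀ θ : ℝ, multiScrewMotion Λ θ '' generalizedHelicoid N Λ = generalizedHelicoid N Λ) ∧
    -- for `λ_0 = 0`, a minimal cone in `ℝ^{L(2N+2)}`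
    (Λ 0 = 0 →
      (∀ q ∈ generalizedHelicoid N Λ, q.snd = 0) ∧
      (∀ c : ℝ, ∀ z ∈ generalizedHelicoidCone N Λ, c • z ∈ generalizedHelicoidCone N Λ) ∧
      (Λ ≠ 0 → IsMinimalSubmanifoldWith (L * (2 * N + 1) + 1) (helicoidDomain L N)
        (helicoidConeMap N Λ) (generalizedHelicoidCone N Λ)) ∧
      (Λ = 0 → IsMinimalSubmanifoldWith (L * (2 * N + 1)) (productConeDomain L N)
        (helicoidConeMap N Λ) (generalizedHelicoidCone N Λ))) := by
  refine ⟨fun hΛ => ?_, ?_, image_multiScrewMotion Λ, fun h0 => ⟨?_, fun c z hz =>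
    smul_mem_generalizedHelicoidCone Λ c hz, fun hΛ => ?_, ?_⟩⟩
  · rw [← image_helicoidMap]
    refine isMinimalSubmanifoldWith_helicoidDomain (contDiff_helicoidMap Λ)
      (fun q z hq hr hXY hz hFz => ?_) fun p => hasReversingSymmetry_helicoidMap_of_injective Λ
    obtain ⟨h1, h2⟩ := (fderiv_helicoidMap_eq_zero_iff Λ q z).mp hFz
    refine eq_zero_of_fderiv_helicoidConeMap_eq_zero Λ hq hr hz h1 ?_
    -- If λ_0 ≠ 0, the axis coordinate already forces dΘ = 0; otherwise some λ_t is nonzero and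
    -- ⟨X_t, Y_t⟩ ≠ 0 does.
    by_cases h0 : Λ 0 = 0
    · obtain ⟨t, ht⟩ := exists_succ_ne_zero hΛ h0
      exact Or.inr ⟨t, mul_ne_zero ht (hXY t)⟩
    · exact Or.inl ((mul_eq_zero.mp h2).resolve_left h0)
  · rintro rfl
    rw [← image_helicoidMap, ← image_productConeDomain helicoidMap_zero_angle]
    refine isMinimalSubmanifoldWith_productConeDomain (contDiff_helicoidMap 0)
      (fun q z hq hr hz hθ hFz => ?_) fun p => hasReversingSymmetry_helicoidMap_of_injective 0
    exact eq_zero_of_fderiv_helicoidConeMap_eq_zero 0 hq hr hz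
      ((fderiv_helicoidMap_eq_zero_iff 0 q z).mp hFz).1 (Or.inl hθ)
  · rintro q ⟨X, Y, Θ, r, -, -, h⟩
    rw [h, h0, zero_mul]
  · rw [← image_helicoidConeMap]
    refine isMinimalSubmanifoldWith_helicoidDomain (contDiff_helicoidConeMap Λ)
      (fun q z hq hr hXY hz hFz => ?_) fun p => hasReversingSymmetry_helicoidConeMap_of_injective Λ
    obtain ⟨t, ht⟩ := exists_succ_ne_zero hΛ h0
    exact eq_zero_of_fderiv_helicoidConeMap_eq_zero Λ hq hr hz hFz
      (Or.inr ⟨t, mul_ne_zero ht (hXY t)⟩)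
  · rintro rfl
    rw [← image_helicoidConeMap, ← image_productConeDomain helicoidConeMap_zero_angle]
    refine isMinimalSubmanifoldWith_productConeDomain (contDiff_helicoidConeMap 0)
      (fun q z hq hr hz hθ hFz => ?_) fun p => hasReversingSymmetry_helicoidConeMap_of_injective 0
    exact eq_zero_of_fderiv_helicoidConeMap_eq_zero 0 hq hr hz hFz (Or.inl hθ)
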